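/- Identify the conics of $\mathbb{CP}^2$ with the points of $\mathbb{CP}^5$, the point $[x_0:\dots:x_5]$ corresponding to the conic $\{[v] : v^{T}Cv=0\}$ with symmetric matrix $$C=\begin{pmatrix}x_0&x_1&x_2\\x_1&x_3&x_4\\x_2&x_4&x_5\end{pmatrix},$$ so that $C$ is determined up to a nonzero scalar. For two conics with matrices $C,D$ write $$\det(tC+D)=\sigma_{30}t^3+\sigma_{21}t^2+\sigma_{12}t+\sigma_{03}.$$ Let $\mathfrak{C}\subset\mathbb{CP}^5\times\mathbb{CP}^5$ (the Cayley set) be the set of pairs $(C,D)$ of conics such that $\det C\neq 0$, $\det D\neq 0$, the conics $C$ and $D$ intersect transversely (i.e. at each common point their tangent lines are distinct), and $$-\sigma_{12}^2+4\sigma_{03}\sigma_{21}=0 .$$ Then $\mathfrak{C}$ is a connected complex manifold of dimension $9$: with the subspace topology it is nonempty, connected, Hausdorff and second countable, and it carries the structure of a $9$-dimensional complex manifold for which the inclusion $\mathfrak{C}\hookrightarrow\mathbb{CP}^5\times\mathbb{CP}^5$ is a holomorphic embedding. -/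

import Mathlib

open scoped LinearAlgebra.Projectivization Manifold ContDiff Matrix

noncomputable section

/-! ### Complex projective space as a complex manifold -/

namespace ComplexProjective

variable {n : ℕ}

/-- The classical topology on `ℂℙⁿ`: the quotient topology from `ℂⁿ⁺¹ ∖ {0}`. -/
instance instTopologicalSpace : TopologicalSpace (ℙ ℂ (Fin (n + 1) → ℂ)) :=
  TopologicalSpace.coinduced (Projectivization.mk' ℂ) inferInstance

theorem isQuotientMap_mk' :
    Topology.IsQuotientMap (Projectivization.mk' ℂ (V := Fin (n + 1) → ℂ)) :=
  ⟨⟨rfl⟩, Quotient.mk''_surjective⟩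

theorem rep_mk_ne_zero_iff (v : Fin (n + 1) → ℂ) (hv : v ≠ 0) (i : Fin (n + 1)) :
    (Projectivization.mk ℂ v hv).rep i ≠ 0 ↔ v i ≠ 0 := by
  obtain ⟨a, ha⟩ := Projectivization.exists_smul_eq_mk_rep ℂ v hv
  rw [← ha]
  simp [Units.smul_def]

theorem rep_mk_div (v : Fin (n + 1) → ℂ) (hv : v ≠ 0) (i k : Fin (n + 1)) :
    (Projectivization.mk ℂ v hv).rep k / (Projectivization.mk ℂ v hv).rep i = v k / v i := by
  obtain ⟨a, ha⟩ := Projectivization.exists_smul_eq_mk_rep ℂ v hv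
  rw [← ha]
  simp only [Units.smul_def, Pi.smul_apply, smul_eq_mul]
  rw [mul_div_mul_left _ _ a.ne_zero]

theorem insertNth_one_ne_zero (i : Fin (n + 1)) (y : Fin n → ℂ) :
    (i.insertNth (1 : ℂ) y : Fin (n + 1) → ℂ) ≠ 0 := by
  intro h
  have := congrFun h i
  simp at this

theorem isOpen_coord_ne_zero (i : Fin (n + 1)) :
    IsOpen {p : ℙ ℂ (Fin (n + 1) → ℂ) | p.rep i ≠ 0} := by
  rw [← isQuotientMap_mk'.isOpen_preimage]
  have : (Projectivization.mk' ℂ (V := Fin (n + 1) → ℂ)) ⁻¹' {p | p.rep i ≠ 0}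
      = {v : {v : Fin (n + 1) → ℂ // v ≠ 0} | v.1 i ≠ 0} := by
    ext v
    exact rep_mk_ne_zero_iff v.1 v.2 i
  rw [this]
  exact isOpen_ne_fun ((continuous_apply i).comp continuous_subtype_val) continuous_const

/-- The standard affine chart of `ℂℙⁿ` on `{xᵢ ≠ 0}`, sending `[x]` to the `n` ratios `xₖ / xᵢ`
with `k ≠ i`; its inverse puts `1` in the `i`-th slot. -/
def affineChart (i : Fin (n + 1)) :
    OpenPartialHomeomorph (ℙ ℂ (Fin (n + 1) → ℂ)) (Fin n → ℂ) where
  toFun p := fun j => p.rep (i.succAbove j) / p.rep i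
  invFun y := Projectivization.mk ℂ (i.insertNth (1 : ℂ) y) (insertNth_one_ne_zero i y)
  source := {p | p.rep i ≠ 0}
  target := Set.univ
  map_source' _ _ := Set.mem_univ _
  map_target' y _ := by
    rw [Set.mem_ofPred_eq, rep_mk_ne_zero_iff]
    simp
  left_inv' p hp := by
    induction p with
    | h v hv =>
      rw [Set.mem_ofPred_eq, rep_mk_ne_zero_iff] at hp
      rw [Projectivization.mk_eq_mk_iff']
      refine ⟨(v i)⁻¹, ?_⟩
      ext k
      refine Fin.succAboveCases i ?_ (fun j => ?_) k
      · simp [hp]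
      · simp only [Pi.smul_apply, smul_eq_mul, Fin.insertNth_apply_succAbove, rep_mk_div]
        rw [div_eq_inv_mul]
  right_inv' y _ := by
    ext j
    simp only [rep_mk_div]
    simp
  open_source := isOpen_coord_ne_zero i
  open_target := isOpen_univ
  continuousOn_toFun := by
    rw [isQuotientMap_mk'.continuousOn_isOpen_iff (isOpen_coord_ne_zero i)]
    have : ∀ v : {v : Fin (n + 1) → ℂ // v ≠ 0},
        ((fun p : ℙ ℂ (Fin (n + 1) → ℂ) => fun j => p.rep (i.succAbove j) / p.rep i) ∘
          Projectivization.mk' ℂ) v = fun j => v.1 (i.succAbove j) / v.1 i := by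
      intro v
      ext j
      exact rep_mk_div v.1 v.2 i _
    refine ContinuousOn.congr ?_ (fun v _ => this v)
    refine continuousOn_pi.2 fun j => ContinuousOn.div ?_ ?_ ?_
    · exact ((continuous_apply _).comp continuous_subtype_val).continuousOn
    · exact ((continuous_apply _).comp continuous_subtype_val).continuousOn
    · intro v hv
      exact (rep_mk_ne_zero_iff v.1 v.2 i).1 hv
  continuousOn_invFun := by
    refine Continuous.continuousOn ?_
    have h : Continuous fun y : Fin n → ℂ =>
        (⟨i.insertNth (1 : ℂ) y, insertNth_one_ne_zero i y⟩ : {v : Fin (n + 1) → ℂ // v ≠ 0}) := by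
      refine Continuous.subtype_mk ?_ _
      refine continuous_pi fun k => ?_
      refine Fin.succAboveCases i ?_ (fun j => ?_) k
      · simpa using continuous_const
      · simpa using continuous_apply j
    exact isQuotientMap_mk'.continuous.comp h

theorem exists_rep_ne_zero (p : ℙ ℂ (Fin (n + 1) → ℂ)) : ∃ i, p.rep i ≠ 0 := by
  by_contra! h
  exact p.rep_nonzero (funext h)

/-- The atlas of standard affine charts. -/
instance instChartedSpace : ChartedSpace (Fin n → ℂ) (ℙ ℂ (Fin (n + 1) → ℂ)) where
  atlas := Set.range affineChart
  chartAt p := affineChart (exists_rep_ne_zero p).choose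
  mem_chart_source p := (exists_rep_ne_zero p).choose_spec
  chart_mem_atlas _ := Set.mem_range_self _

/-- `ℂℙⁿ` is a complex (analytic) manifold of dimension `n`. -/
instance instIsManifold : IsManifold 𝓘(ℂ, Fin n → ℂ) ω (ℙ ℂ (Fin (n + 1) → ℂ)) := by
  apply isManifold_of_contDiffOn
  rintro _ _ ⟨i, rfl⟩ ⟨k, rfl⟩
  have hcoord : ∀ m : Fin (n + 1), ContDiff ℂ ω
      (fun y : Fin n → ℂ => (i.insertNth (1 : ℂ) y : Fin (n + 1) → ℂ) m) := by
    intro m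
    refine Fin.succAboveCases i ?_ (fun j => ?_) m
    · simpa using contDiff_const
    · simpa using contDiff_apply ℂ ℂ j
  have key : ContDiffOn ℂ ω (fun (y : Fin n → ℂ) (j : Fin n) =>
      (i.insertNth (1 : ℂ) y : Fin (n + 1) → ℂ) (k.succAbove j) /
        (i.insertNth (1 : ℂ) y : Fin (n + 1) → ℂ) k)
      {y | (i.insertNth (1 : ℂ) y : Fin (n + 1) → ℂ) k ≠ 0} :=
    contDiffOn_pi.2 fun j => (hcoord _).contDiffOn.div (hcoord _).contDiffOn fun _ hy => hy
  refine (key.congr ?_).mono ?_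
  · intro y _
    ext j
    exact rep_mk_div _ (insertNth_one_ne_zero i y) k _
  · intro y hy
    have h2 : (affineChart i).symm y ∈ (affineChart k).source := hy.1.2
    exact (rep_mk_ne_zero_iff _ (insertNth_one_ne_zero i y) k).1 h2

end ComplexProjective

/-! ### Pairs of conics and the Cayley set -/

namespace Conics

/-- The symmetric matrix with entries `x₀, …, x₅`, defining a conic in `ℂℙ²`. -/
def conicMatrix (x : Fin 6 → ℂ) : Matrix (Fin 3) (Fin 3) ℂ :=
  !![x 0, x 1, x 2;
     x 1, x 3, x 4;
     x 2, x 4, x 5]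

/-- The polynomial `P(t) = det (t C + D)`. -/
def pencilDet (C D : Matrix (Fin 3) (Fin 3) ℂ) : Polynomial ℂ :=
  Matrix.det ((Polynomial.X : Polynomial ℂ) • C.map Polynomial.C + D.map Polynomial.C)

/-- `σ₂₁`, the coefficient of `t²` in `det (t C + D)`. -/
def sigma21 (C D : Matrix (Fin 3) (Fin 3) ℂ) : ℂ := (pencilDet C D).coeff 2

/-- `σ₁₂`, the coefficient of `t` in `det (t C + D)`. -/
def sigma12 (C D : Matrix (Fin 3) (Fin 3) ℂ) : ℂ := (pencilDet C D).coeff 1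

/-- `σ₀₃`, the constant coefficient of `det (t C + D)`, which is `det D`. -/
def sigma03 (C D : Matrix (Fin 3) (Fin 3) ℂ) : ℂ := (pencilDet C D).coeff 0

/-- The conics with matrices `C` and `D` meet transversely: at every common point `[v]` of
`ℂℙ²` both gradients `C v` and `D v` are nonzero and not proportional, so both conics are smooth
at `[v]` and their tangent lines there are distinct. -/
def MeetTransversely (C D : Matrix (Fin 3) (Fin 3) ℂ) : Prop :=
  ∀ v : Fin 3 → ℂ, v ≠ 0 → v ⬝ᵥ (C *ᵥ v) = 0 → v ⬝ᵥ (D *ᵥ v) = 0 →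
    LinearIndependent ℂ ![C *ᵥ v, D *ᵥ v]

/-- The conditions on matrices of a pair of conics that define the Cayley set. -/
structure IsCayleyPair (C D : Matrix (Fin 3) (Fin 3) ℂ) : Prop where
  det_left_ne_zero : C.det ≠ 0
  det_right_ne_zero : D.det ≠ 0
  transverse : MeetTransversely C D
  cayley : -(sigma12 C D) ^ 2 + 4 * sigma03 C D * sigma21 C D = 0

/-- The Cayley set `𝔆 ⊆ ℂℙ⁵ × ℂℙ⁵`. The conditions do not depend on the representatives, see
`mem_cayleySet_mk`. -/
def cayleySet : Set (ℙ ℂ (Fin 6 → ℂ) × ℙ ℂ (Fin 6 → ℂ)) :=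
  {p | IsCayleyPair (conicMatrix p.1.rep) (conicMatrix p.2.rep)}

theorem conicMatrix_smul (a : ℂ) (x : Fin 6 → ℂ) :
    conicMatrix (a • x) = a • conicMatrix x := by
  ext i j
  fin_cases i <;> fin_cases j <;> simp [conicMatrix]

theorem pencilDet_eq (C D : Matrix (Fin 3) (Fin 3) ℂ) :
    pencilDet C D = Polynomial.C C.det * Polynomial.X ^ 3 +
      Polynomial.C (D 0 0 * C 1 1 * C 2 2 + C 0 0 * D 1 1 * C 2 2 + C 0 0 * C 1 1 * D 2 2
      - D 0 0 * C 1 2 * C 2 1 - C 0 0 * D 1 2 * C 2 1 - C 0 0 * C 1 2 * D 2 1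
      - D 0 1 * C 1 0 * C 2 2 - C 0 1 * D 1 0 * C 2 2 - C 0 1 * C 1 0 * D 2 2
      + D 0 1 * C 1 2 * C 2 0 + C 0 1 * D 1 2 * C 2 0 + C 0 1 * C 1 2 * D 2 0
      + D 0 2 * C 1 0 * C 2 1 + C 0 2 * D 1 0 * C 2 1 + C 0 2 * C 1 0 * D 2 1
      - D 0 2 * C 1 1 * C 2 0 - C 0 2 * D 1 1 * C 2 0 - C 0 2 * C 1 1 * D 2 0) * Polynomial.X ^ 2 +
      Polynomial.C (C 0 0 * D 1 1 * D 2 2 + D 0 0 * C 1 1 * D 2 2 + D 0 0 * D 1 1 * C 2 2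
      - C 0 0 * D 1 2 * D 2 1 - D 0 0 * C 1 2 * D 2 1 - D 0 0 * D 1 2 * C 2 1
      - C 0 1 * D 1 0 * D 2 2 - D 0 1 * C 1 0 * D 2 2 - D 0 1 * D 1 0 * C 2 2
      + C 0 1 * D 1 2 * D 2 0 + D 0 1 * C 1 2 * D 2 0 + D 0 1 * D 1 2 * C 2 0
      + C 0 2 * D 1 0 * D 2 1 + D 0 2 * C 1 0 * D 2 1 + D 0 2 * D 1 0 * C 2 1
      - C 0 2 * D 1 1 * D 2 0 - D 0 2 * C 1 1 * D 2 0 - D 0 2 * D 1 1 * C 2 0) * Polynomial.X +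
      Polynomial.C D.det := by
  simp only [pencilDet, Matrix.det_fin_three, Matrix.add_apply, Matrix.smul_apply,
    Matrix.map_apply, smul_eq_mul, map_add, map_sub, map_mul]
  ring

theorem sigma21_eq (C D : Matrix (Fin 3) (Fin 3) ℂ) :
    sigma21 C D = D 0 0 * C 1 1 * C 2 2 + C 0 0 * D 1 1 * C 2 2 + C 0 0 * C 1 1 * D 2 2
      - D 0 0 * C 1 2 * C 2 1 - C 0 0 * D 1 2 * C 2 1 - C 0 0 * C 1 2 * D 2 1
      - D 0 1 * C 1 0 * C 2 2 - C 0 1 * D 1 0 * C 2 2 - C 0 1 * C 1 0 * D 2 2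
      + D 0 1 * C 1 2 * C 2 0 + C 0 1 * D 1 2 * C 2 0 + C 0 1 * C 1 2 * D 2 0
      + D 0 2 * C 1 0 * C 2 1 + C 0 2 * D 1 0 * C 2 1 + C 0 2 * C 1 0 * D 2 1
      - D 0 2 * C 1 1 * C 2 0 - C 0 2 * D 1 1 * C 2 0 - C 0 2 * C 1 1 * D 2 0 := by
  rw [sigma21, pencilDet_eq, Polynomial.coeff_add, Polynomial.coeff_add, Polynomial.coeff_add,
    Polynomial.coeff_C_mul_X_pow, Polynomial.coeff_C_mul_X_pow, Polynomial.coeff_C_mul_X,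
    Polynomial.coeff_C]
  simp

theorem sigma12_eq (C D : Matrix (Fin 3) (Fin 3) ℂ) :
    sigma12 C D = C 0 0 * D 1 1 * D 2 2 + D 0 0 * C 1 1 * D 2 2 + D 0 0 * D 1 1 * C 2 2
      - C 0 0 * D 1 2 * D 2 1 - D 0 0 * C 1 2 * D 2 1 - D 0 0 * D 1 2 * C 2 1
      - C 0 1 * D 1 0 * D 2 2 - D 0 1 * C 1 0 * D 2 2 - D 0 1 * D 1 0 * C 2 2
      + C 0 1 * D 1 2 * D 2 0 + D 0 1 * C 1 2 * D 2 0 + D 0 1 * D 1 2 * C 2 0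
      + C 0 2 * D 1 0 * D 2 1 + D 0 2 * C 1 0 * D 2 1 + D 0 2 * D 1 0 * C 2 1
      - C 0 2 * D 1 1 * D 2 0 - D 0 2 * C 1 1 * D 2 0 - D 0 2 * D 1 1 * C 2 0 := by
  rw [sigma12, pencilDet_eq, Polynomial.coeff_add, Polynomial.coeff_add, Polynomial.coeff_add,
    Polynomial.coeff_C_mul_X_pow, Polynomial.coeff_C_mul_X_pow, Polynomial.coeff_C_mul_X,
    Polynomial.coeff_C]
  simp

theorem sigma03_eq (C D : Matrix (Fin 3) (Fin 3) ℂ) : sigma03 C D = D.det := by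
  rw [sigma03, pencilDet_eq, Polynomial.coeff_add, Polynomial.coeff_add, Polynomial.coeff_add,
    Polynomial.coeff_C_mul_X_pow, Polynomial.coeff_C_mul_X_pow, Polynomial.coeff_C_mul_X,
    Polynomial.coeff_C]
  simp

theorem sigma_smul (a b : ℂ) (C D : Matrix (Fin 3) (Fin 3) ℂ) :
    sigma21 (a • C) (b • D) = a ^ 2 * b * sigma21 C D ∧
      sigma12 (a • C) (b • D) = a * b ^ 2 * sigma12 C D ∧
      sigma03 (a • C) (b • D) = b ^ 3 * sigma03 C D := by
  simp only [sigma21_eq, sigma12_eq, sigma03_eq, Matrix.det_smul, Matrix.smul_apply, smul_eq_mul,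
    Fintype.card_fin]
  refine ⟨?_, ?_, trivial⟩ <;> ring

theorem IsCayleyPair.smul {a b : ℂ} (ha : a ≠ 0) (hb : b ≠ 0)
    {C D : Matrix (Fin 3) (Fin 3) ℂ} (h : IsCayleyPair C D) :
    IsCayleyPair (a • C) (b • D) where
  det_left_ne_zero := by
    rw [Matrix.det_smul]
    exact mul_ne_zero (pow_ne_zero _ ha) h.det_left_ne_zero
  det_right_ne_zero := by
    rw [Matrix.det_smul]
    exact mul_ne_zero (pow_ne_zero _ hb) h.det_right_ne_zero
  transverse := by
    intro v hv h1 h2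
    rw [Matrix.smul_mulVec, dotProduct_smul, smul_eq_zero] at h1 h2
    have := h.transverse v hv (h1.resolve_left ha) (h2.resolve_left hb)
    rw [Matrix.smul_mulVec, Matrix.smul_mulVec, LinearIndependent.pair_iff]
    rw [LinearIndependent.pair_iff] at this
    intro s t hst
    rw [smul_smul, smul_smul] at hst
    obtain ⟨h3, h4⟩ := this _ _ hst
    exact ⟨(mul_eq_zero.1 h3).resolve_right ha, (mul_eq_zero.1 h4).resolve_right hb⟩
  cayley := by
    obtain ⟨h1, h2, h3⟩ := sigma_smul a b C D
    rw [h1, h2, h3]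
    linear_combination a ^ 2 * b ^ 4 * h.cayley

/-- Membership in the Cayley set can be tested on any homogeneous coordinates. -/
theorem mem_cayleySet_mk (x y : Fin 6 → ℂ) (hx : x ≠ 0) (hy : y ≠ 0) :
    (Projectivization.mk ℂ x hx, Projectivization.mk ℂ y hy) ∈ cayleySet ↔
      IsCayleyPair (conicMatrix x) (conicMatrix y) := by
  obtain ⟨a, ha⟩ := Projectivization.exists_smul_eq_mk_rep ℂ x hx
  obtain ⟨b, hb⟩ := Projectivization.exists_smul_eq_mk_rep ℂ y hy
  simp only [cayleySet, Set.mem_ofPred_eq, ← ha, ← hb, Units.smul_def, conicMatrix_smul]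
  refine ⟨fun h => ?_, fun h => h.smul a.ne_zero b.ne_zero⟩
  have := h.smul (inv_ne_zero a.ne_zero) (inv_ne_zero b.ne_zero)
  rwa [smul_smul, smul_smul, inv_mul_cancel₀ a.ne_zero, inv_mul_cancel₀ b.ne_zero, one_smul,
    one_smul] at this

/-- For `det D ≠ 0` the Cayley equation says that `A₂ = 0` in the Taylor expansion
`√(det (t C + D)) = A₀ + A₁ t + A₂ t² + ⋯`, for either choice of the square root. -/
theorem cayley_equation_iff_coeff_two_eq_zero (C D : Matrix (Fin 3) (Fin 3) ℂ)
    (hD : sigma03 C D ≠ 0) (φ : PowerSeries ℂ) (hφ : φ ^ 2 = (pencilDet C D : PowerSeries ℂ)) :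
    -(sigma12 C D) ^ 2 + 4 * sigma03 C D * sigma21 C D = 0 ↔ PowerSeries.coeff 2 φ = 0 := by
  have hc : ∀ k, PowerSeries.coeff k (φ ^ 2) = (pencilDet C D).coeff k := by
    intro k
    rw [hφ, Polynomial.coeff_coe]
  have h0 := hc 0
  have h1 := hc 1
  have h2 := hc 2
  simp only [pow_two, PowerSeries.coeff_mul, Finset.Nat.antidiagonal_succ,
    Finset.Nat.antidiagonal_zero] at h0 h1 h2
  simp only [Finset.sum_cons, Finset.map_singleton, Finset.sum_singleton,
    Finset.map_cons, Function.Embedding.prodMap, Function.Embedding.coeFn_mk, Prod.map,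
    Function.Embedding.refl_apply, Nat.succ_eq_add_one] at h0 h1 h2
  norm_num at h0 h1 h2
  have e : -(sigma12 C D) ^ 2 + 4 * sigma03 C D * sigma21 C D
      = 8 * (PowerSeries.constantCoeff φ) ^ 3 * PowerSeries.coeff 2 φ := by
    rw [sigma12, sigma03, sigma21, ← h0, ← h1, ← h2]
    ring
  have hne : PowerSeries.constantCoeff φ ≠ 0 := by
    intro hz
    apply hD
    rw [sigma03, ← h0, hz, mul_zero]
  rw [e]
  simp [hne]

end Conics

end

/-! Smoothness. For fixed `D` with adjugate `K`, the Cayley expression is a quadratic form in `C`,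
namely `(tr KC)² - 2 tr (KC)²` (`cayleyForm_eq_traceForm`). When `det D ≠ 0` this form is
nondegenerate on symmetric matrices (`eq_zero_of_tracePolar_eq_zero`), so at a zero the derivative
in `C` alone is already nonzero, in homogeneous coordinates and, by Euler's relation, in affine ones
(`fderiv_affineCayley_ne_zero`). The determinant conditions are open, and so is transversality
(`isOpen_meetTransversely`), so locally the Cayley set is a regular hypersurface in a manifold of
dimension 10. The inverse function theorem turns this into slice charts, and these give the manifold
structure and the embedding.

Connectedness. An isotropic common eigenvector would be a common point with a common tangent, so
transversality forces simultaneous diagonalization: `C = Pᵀ L P`, `D = Pᵀ P`, with distinct nonzero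
eigenvalues (`exists_simultaneous_diagonalization`). On the eigenvalues the Cayley equation becomes
`(l₀ + l₁ + l₂)² = 4 (l₀l₁ + l₀l₂ + l₁l₂)`, which says that they are `a², b², (a + b)²` for suitable
square roots. The Cayley set is thus a continuous image of the triples `(P, a, b)` where a certain
polynomial does not vanish, and the complement of a complex hypersurface is connected. -/

noncomputable section

/-! ### Submanifolds from slice charts -/

section Slice

variable {𝕜 : Type*} [NontriviallyNormedField 𝕜]
  {E F E' : Type*} [NormedAddCommGroup E] [NormedSpace 𝕜 E]
  [NormedAddCommGroup F] [NormedSpace 𝕜 F] [NormedAddCommGroup E'] [NormedSpace 𝕜 E']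
  {M : Type*} [TopologicalSpace M] [ChartedSpace E' M] {n : WithTop ℕ∞}

variable (𝕜 E F E' n) in
/-- A chart of the ambient manifold in which the subset `S` is the slice `E × {0}` of `E × F`. -/
structure SliceChart (S : Set M) where
  chart : OpenPartialHomeomorph M E'
  mem_maximalAtlas : chart ∈ IsManifold.maximalAtlas 𝓘(𝕜, E') n M
  equiv : (E × F) ≃L[𝕜] E'
  mem_iff : ∀ x ∈ chart.source, x ∈ S ↔ (equiv.symm (chart x)).2 = 0

namespace SliceChart

variable {S : Set M}

theorem equiv_fst_zero (s : SliceChart 𝕜 E F E' n S) {x : M} (hx : x ∈ s.chart.source)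
    (hS : x ∈ S) : s.equiv ((s.equiv.symm (s.chart x)).1, 0) = s.chart x := by
  have h := (s.mem_iff x hx).1 hS
  conv_rhs => rw [← s.equiv.apply_symm_apply (s.chart x)]
  rw [← h]

theorem symm_mem (s : SliceChart 𝕜 E F E' n S) {u : E} (hu : s.equiv (u, 0) ∈ s.chart.target) :
    s.chart.symm (s.equiv (u, 0)) ∈ S := by
  rw [s.mem_iff _ (s.chart.map_target hu), s.chart.right_inv hu]
  simp

open Classical in
/-- The chart of `S` induced by a slice chart. -/
def toChart [Nonempty S] (s : SliceChart 𝕜 E F E' n S) : OpenPartialHomeomorph S E where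
  toFun x := (s.equiv.symm (s.chart x)).1
  -- The value off the target is never used; it only makes the function total.
  invFun u := if h : s.equiv (u, 0) ∈ s.chart.target then ⟨_, s.symm_mem h⟩ else Classical.arbitrary S
  source := Subtype.val ⁻¹' s.chart.source
  target := {u | s.equiv (u, 0) ∈ s.chart.target}
  map_source' x hx := by
    rw [Set.mem_ofPred_eq, s.equiv_fst_zero hx x.2]
    exact s.chart.map_source hx
  map_target' u hu := by
    rw [Set.mem_ofPred_eq] at hu
    rw [dif_pos hu]
    exact s.chart.map_target hu
  left_inv' x hx := by
    have h : s.equiv ((s.equiv.symm (s.chart x)).1, 0) ∈ s.chart.target := by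
      rw [s.equiv_fst_zero hx x.2]
      exact s.chart.map_source hx
    rw [dif_pos h]
    ext
    dsimp only
    rw [s.equiv_fst_zero hx x.2, s.chart.left_inv hx]
  right_inv' u hu := by
    rw [Set.mem_ofPred_eq] at hu
    rw [dif_pos hu]
    dsimp only
    rw [s.chart.right_inv hu]
    simp
  open_source := s.chart.open_source.preimage continuous_subtype_val
  open_target := s.chart.open_target.preimage (by fun_prop)
  continuousOn_toFun := by
    refine (continuous_fst.comp s.equiv.symm.continuous).comp_continuousOn ?_
    exact s.chart.continuousOn.comp continuous_subtype_val.continuousOn fun x hx => hx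
  continuousOn_invFun := by
    rw [Topology.IsInducing.subtypeVal.continuousOn_iff]
    have : ContinuousOn (fun u : E => s.chart.symm (s.equiv (u, 0)))
        {u | s.equiv (u, 0) ∈ s.chart.target} :=
      s.chart.continuousOn_symm.comp (by fun_prop) fun u hu => hu
    refine this.congr fun u hu => ?_
    rw [Set.mem_ofPred_eq] at hu
    simp [hu]

variable [Nonempty S]

open Classical in
theorem toChart_symm_coe (s : SliceChart 𝕜 E F E' n S) {u : E} (hu : u ∈ s.toChart.target) :
    (s.toChart.symm u : M) = s.chart.symm (s.equiv (u, 0)) := by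
  have hu' : s.equiv (u, 0) ∈ s.chart.target := hu
  change ((if h : s.equiv (u, 0) ∈ s.chart.target then ⟨_, s.symm_mem h⟩
    else Classical.arbitrary S : S) : M) = _
  rw [dif_pos hu']

/-- The transition is an ambient transition map composed with the linear inclusion `u ↦ (u, 0)`
before and the linear projection to `E` after. -/
theorem contDiffOn_transition (s t : SliceChart 𝕜 E F E' n S) :
    ContDiffOn 𝕜 n (s.toChart.symm ≫ₕ t.toChart) (s.toChart.symm ≫ₕ t.toChart).source := by
  have h : ContDiffOn 𝕜 n (s.chart.symm ≫ₕ t.chart) (s.chart.symm ≫ₕ t.chart).source := by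
    have := (mem_groupoid_of_pregroupoid.1 (StructureGroupoid.compatible_of_mem_maximalAtlas
      s.mem_maximalAtlas t.mem_maximalAtlas)).1
    simpa [contDiffPregroupoid] using this
  have h2 : ContDiffOn 𝕜 n (fun u : E => (t.equiv.symm ((s.chart.symm ≫ₕ t.chart)
      (s.equiv (u, 0)))).1) (s.toChart.symm ≫ₕ t.toChart).source := by
    refine (contDiff_fst.comp t.equiv.symm.contDiff).comp_contDiffOn ?_
    refine h.comp (ContDiff.contDiffOn ?_) ?_
    · exact s.equiv.contDiff.comp (contDiff_id.prodMk contDiff_const)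
    · intro u hu
      have h3 := s.toChart_symm_coe hu.1
      refine ⟨hu.1, ?_⟩
      have h4 : ((s.toChart.symm u : S) : M) ∈ t.chart.source := hu.2
      rw [h3] at h4
      exact h4
  refine h2.congr fun u hu => ?_
  change (t.equiv.symm (t.chart (s.toChart.symm u : S))).1 = _
  rw [s.toChart_symm_coe hu.1]
  rfl

end SliceChart

/-- A subset covered by slice charts is an embedded submanifold. -/
theorem exists_isSmoothEmbedding_of_sliceChart {S : Set M} (hS : S.Nonempty)
    (h : ∀ x ∈ S, ∃ s : SliceChart 𝕜 E F E' n S, x ∈ s.chart.source)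
    [IsManifold 𝓘(𝕜, E') n M] :
    ∃ _ : ChartedSpace E S, IsManifold 𝓘(𝕜, E) n S ∧
      Manifold.IsSmoothEmbedding 𝓘(𝕜, E) 𝓘(𝕜, E') n (Subtype.val : S → M) := by
  have : Nonempty S := hS.to_subtype
  have h' : ∀ x : S, ∃ s : SliceChart 𝕜 E F E' n S, (x : M) ∈ s.chart.source := fun x => h x x.2
  choose s hs using h'
  let cs : ChartedSpace E S :=
    { atlas := Set.range fun s : SliceChart 𝕜 E F E' n S => s.toChart
      chartAt := fun x => (s x).toChart
      mem_chart_source := fun x => hs x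
      chart_mem_atlas := fun x => Set.mem_range_self (s x) }
  have hm : IsManifold 𝓘(𝕜, E) n S := by
    apply isManifold_of_contDiffOn
    rintro _ _ ⟨s, rfl⟩ ⟨t, rfl⟩
    simpa using s.contDiffOn_transition t
  refine ⟨cs, hm, ?_, Topology.IsEmbedding.subtypeVal⟩
  refine Manifold.IsImmersionOfComplement.isImmersion (F := F) fun x => ?_
  refine Manifold.IsImmersionAtOfComplement.mk_of_charts (s x).equiv (s x).toChart (s x).chart
    (hs x) (hs x) (IsManifold.subset_maximalAtlas (Set.mem_range_self (s x)))
    (s x).mem_maximalAtlas subset_rfl ?_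
  -- In the chosen pair of charts the inclusion reads `u ↦ (u, 0)`, which is the normal form of an
  -- immersion with complement `F`.
  intro u hu
  have hu' : u ∈ (s x).toChart.target := by simpa using hu
  simp only [Function.comp_apply, OpenPartialHomeomorph.extend_coe,
    OpenPartialHomeomorph.extend_coe_symm, modelWithCornersSelf_coe, id,
    modelWithCornersSelf_coe_symm]
  rw [(s x).toChart_symm_coe hu', (s x).chart.right_inv hu']

end Slice

/-! ### Regular zero sets -/

section RegularZero

variable {𝕜 : Type*} [RCLike 𝕜] {E' : Type*} [NormedAddCommGroup E'] [NormedSpace 𝕜 E']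
  {M : Type*} [TopologicalSpace M] [ChartedSpace E' M] {n : WithTop ℕ∞}

/-- In finite dimension, a nonzero functional is the second projection in suitable linear
coordinates. -/
theorem exists_equiv_snd_eq [FiniteDimensional 𝕜 E'] {m : ℕ} (hm : Module.finrank 𝕜 E' = m + 1)
    (f : E' →L[𝕜] 𝕜) (v : E') (hv : f v = 1) :
    ∃ L : ((Fin m → 𝕜) × 𝕜) ≃L[𝕜] E', ∀ y, (L.symm y).2 = f y := by
  let e := ContinuousLinearEquiv.equivOfRightInverse f (ContinuousLinearMap.toSpanSingleton 𝕜 v)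
    (fun a => by simp [hv])
  have hk : Module.finrank 𝕜 f.ker = Module.finrank 𝕜 (Fin m → 𝕜) := by
    have h := e.toLinearEquiv.finrank_eq
    rw [Module.finrank_prod, Module.finrank_self, hm] at h
    rw [Module.finrank_fin_fun]
    omega
  let k := ContinuousLinearEquiv.ofFinrankEq hk
  refine ⟨((e.trans ((ContinuousLinearEquiv.refl 𝕜 𝕜).prodCongr k)).trans
    (ContinuousLinearEquiv.prodComm 𝕜 𝕜 (Fin m → 𝕜))).symm, fun y => ?_⟩
  simp [e]

/-- This is the inverse function theorem, with the domain shrunk to the open set where the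
derivative is invertible, so that the inverse is smooth on the whole target and not only at the
image of `a`. -/
theorem exists_openPartialHomeomorph_contDiffGroupoid [CompleteSpace E'] (hn : n ≠ 0)
    {f : E' → E'} (hf : ContDiff 𝕜 n f) {a : E'} {f' : E' ≃L[𝕜] E'}
    (hf' : HasFDerivAt f (f' : E' →L[𝕜] E') a) :
    ∃ φ ∈ contDiffGroupoid n 𝓘(𝕜, E'), a ∈ φ.source ∧ ⇑φ = f := by
  let φ₀ := hf.contDiffAt.toOpenPartialHomeomorph f hf' hn
  let U : Set E' := {x | fderiv 𝕜 f x ∈ Set.range ((↑) : (E' ≃L[𝕜] E') → E' →L[𝕜] E')}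
  have hU : IsOpen U := ContinuousLinearEquiv.isOpen.preimage (hf.continuous_fderiv hn)
  refine ⟨φ₀.restrOpen U hU, ?_, ⟨hf.contDiffAt.mem_toOpenPartialHomeomorph_source hf' hn, ?_⟩, rfl⟩
  · rw [contDiffGroupoid, mem_groupoid_of_pregroupoid]
    refine ⟨?_, ?_⟩
    · suffices ContDiffOn 𝕜 n f (φ₀.restrOpen U hU).source by
        simpa [contDiffPregroupoid, φ₀] using this
      exact hf.contDiffOn
    · suffices ContDiffOn 𝕜 n (φ₀.restrOpen U hU).symm (φ₀.restrOpen U hU).target by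
        simpa [contDiffPregroupoid] using this
      intro y hy
      have h1 := (φ₀.restrOpen U hU).map_target hy
      obtain ⟨g, hg⟩ := h1.2
      refine (OpenPartialHomeomorph.contDiffAt_symm (f₀' := g) (φ₀.restrOpen U hU) hy ?_
        hf.contDiffAt).contDiffWithinAt
      rw [hg]
      exact (hf.differentiable hn _).hasFDerivAt
  · exact ⟨f', hf'.fderiv.symm⟩

/-- Near a regular zero of a smooth function, its zero set has a slice chart. -/
theorem exists_sliceChart_of_regular_zero [FiniteDimensional 𝕜 E'] {m : ℕ}
    (hm : Module.finrank 𝕜 E' = m + 1) (hn : n ≠ 0) [IsManifold 𝓘(𝕜, E') n M]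
    {S V : Set M} (hV : IsOpen V) {c : OpenPartialHomeomorph M E'}
    (hc : c ∈ IsManifold.maximalAtlas 𝓘(𝕜, E') n M)
    {g : E' → 𝕜} (hg : ContDiff 𝕜 n g) {p : M} (hpV : p ∈ V) (hpc : p ∈ c.source)
    (hS : ∀ x ∈ V, x ∈ c.source → (x ∈ S ↔ g (c x) = 0)) (hreg : fderiv 𝕜 g (c p) ≠ 0) :
    ∃ s : SliceChart 𝕜 (Fin m → 𝕜) 𝕜 E' n S, p ∈ s.chart.source := by
  have := FiniteDimensional.complete 𝕜 E'
  set f := fderiv 𝕜 g (c p) with hf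
  obtain ⟨w, hw⟩ : ∃ w, f w ≠ 0 := by
    by_contra! h
    exact hreg (ContinuousLinearMap.ext h)
  let v := (f w)⁻¹ • w
  have hv : f v = 1 := by simp [v, hw]
  obtain ⟨L, hL⟩ := exists_equiv_snd_eq hm f v hv
  -- As `f v = 1`, `f ∘ Φ = g`; as `f` is the derivative of `g` at `c p`, `Φ` has derivative the
  -- identity there. So `Φ` straightens `g = 0` to the hyperplane `f = 0`.
  let Φ : E' → E' := fun y => y + (g y - f y) • v
  have hΦ : ContDiff 𝕜 n Φ :=
    contDiff_id.add ((hg.sub f.contDiff).smul contDiff_const)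
  have hΦ' : HasFDerivAt Φ ((ContinuousLinearEquiv.refl 𝕜 E' : E' ≃L[𝕜] E') : E' →L[𝕜] E')
      (c p) := by
    have h1 : HasFDerivAt g f (c p) := (hg.differentiable hn _).hasFDerivAt
    have h2 := (hasFDerivAt_id (c p)).add ((h1.sub f.hasFDerivAt).smul_const v)
    convert h2 using 1
    · rfl
    · ext y
      simp
  obtain ⟨φ, hφ, hpφ, hφΦ⟩ := exists_openPartialHomeomorph_contDiffGroupoid hn hΦ hΦ'
  have hcomp : (c ≫ₕ φ).restr V ∈ IsManifold.maximalAtlas 𝓘(𝕜, E') n M := by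
    refine restr_mem_maximalAtlas _ ?_ hV
    refine mem_maximalAtlas_iff.2 fun e he => ⟨?_, ?_⟩
    · rw [OpenPartialHomeomorph.trans_symm_eq_symm_trans_symm, OpenPartialHomeomorph.trans_assoc]
      exact StructureGroupoid.trans _ (StructureGroupoid.symm _ hφ)
        (StructureGroupoid.compatible_of_mem_maximalAtlas hc (IsManifold.subset_maximalAtlas he))
    · rw [← OpenPartialHomeomorph.trans_assoc]
      exact StructureGroupoid.trans _
        (StructureGroupoid.compatible_of_mem_maximalAtlas (IsManifold.subset_maximalAtlas he) hc) hφ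
  refine ⟨⟨(c ≫ₕ φ).restr V, hcomp, L, fun x hx => ?_⟩, ?_⟩
  · rw [OpenPartialHomeomorph.restr_source, hV.interior_eq] at hx
    rw [hS x hx.2 hx.1.1, hL]
    have : ((c ≫ₕ φ).restr V) x = Φ (c x) := by
      rw [← hφΦ]
      rfl
    rw [this]
    simp [Φ, hv]
  · simp [hV.interior_eq, hpV, hpc, hpφ]

end RegularZero

/-! ### Projective space is second countable and Hausdorff -/

namespace ComplexProjective
variable {n : ℕ}

instance instSecondCountableTopology : SecondCountableTopology (ℙ ℂ (Fin (n + 1) → ℂ)) := by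
  have : ∀ i : Fin (n + 1), SecondCountableTopology (affineChart i).source :=
    fun i => (affineChart i).secondCountableTopology_source
  refine TopologicalSpace.secondCountableTopology_of_countable_cover
    (fun i => (affineChart i).open_source) ?_
  exact Set.eq_univ_of_forall fun p => Set.mem_iUnion.2 (exists_rep_ne_zero p)

/-- The entries of the orthogonal projection onto the line spanned by `v`. -/
def lineProj (v : {v : Fin (n + 1) → ℂ // v ≠ 0}) (i j : Fin (n + 1)) : ℂ :=
  v.1 i * star (v.1 j) / ∑ k, v.1 k * star (v.1 k)

open scoped ComplexOrder in
theorem sum_mul_star_ne_zero {v : Fin (n + 1) → ℂ} (hv : v ≠ 0) :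
    ∑ k, v k * star (v k) ≠ 0 :=
  fun h => hv (dotProduct_self_star_eq_zero.1 h)

theorem lineProj_eq_iff (v w : {v : Fin (n + 1) → ℂ // v ≠ 0}) :
    lineProj v = lineProj w ↔ Projectivization.mk' ℂ v = Projectivization.mk' ℂ w := by
  rw [Projectivization.mk'_eq_mk, Projectivization.mk'_eq_mk, Projectivization.mk_eq_mk_iff']
  have hv := sum_mul_star_ne_zero v.2
  have hw := sum_mul_star_ne_zero w.2
  constructor
  · intro h
    have h' : ∀ i j, v.1 i * star (v.1 j) / ∑ k, v.1 k * star (v.1 k) =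
      w.1 i * star (w.1 j) / ∑ k, w.1 k * star (w.1 k) := fun i j => congrFun (congrFun h i) j
    obtain ⟨j, hj⟩ := Function.ne_iff.1 v.2
    have hj : v.1 j ≠ 0 := hj
    have hj' : star (v.1 j) ≠ 0 := star_ne_zero.2 hj
    -- The scalar is read off from column `j` of the two projections, where `v j ≠ 0`.
    refine ⟨star (w.1 j) / (∑ k, w.1 k * star (w.1 k)) * (∑ k, v.1 k * star (v.1 k)) /
      star (v.1 j), funext fun i => ?_⟩
    have := h' i j
    rw [div_eq_div_iff hv hw] at this
    simp only [Pi.smul_apply, smul_eq_mul]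
    field_simp
    linear_combination -this
  · rintro ⟨a, ha⟩
    have ha0 : a ≠ 0 := by
      rintro rfl
      exact v.2 (by rw [← ha, zero_smul])
    have ha1 : star a ≠ 0 := star_ne_zero.2 ha0
    ext i j
    simp only [lineProj, ← ha, Pi.smul_apply, smul_eq_mul, star_mul']
    have : ∑ k, a * w.1 k * (star a * star (w.1 k)) =
        a * star a * ∑ k, w.1 k * star (w.1 k) := by
      rw [Finset.mul_sum]
      exact Finset.sum_congr rfl fun k _ => by ring
    rw [this]
    field_simp

/-- A line is determined by the orthogonal projection onto it, so `lineProj` descends to a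
continuous injection into a space of matrices. -/
instance instT2Space : T2Space (ℙ ℂ (Fin (n + 1) → ℂ)) := by
  have hcont : Continuous (lineProj (n := n)) := by
    refine continuous_pi fun i => continuous_pi fun j => ?_
    have hc : ∀ k : Fin (n + 1), Continuous fun v : {v : Fin (n + 1) → ℂ // v ≠ 0} => v.1 k :=
      fun k => (continuous_apply k).comp continuous_subtype_val
    exact ((hc i).mul (hc j).star).div
      (continuous_finsetSum _ fun k _ => (hc k).mul (hc k).star)
      fun v => sum_mul_star_ne_zero v.2
  let g : ℙ ℂ (Fin (n + 1) → ℂ) → Fin (n + 1) → Fin (n + 1) → ℂ :=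
    fun p => lineProj ⟨p.rep, p.rep_nonzero⟩
  have hmk : ∀ p : ℙ ℂ (Fin (n + 1) → ℂ), Projectivization.mk' ℂ ⟨p.rep, p.rep_nonzero⟩ = p :=
    fun p => p.mk_rep
  have hg : g ∘ Projectivization.mk' ℂ = lineProj := by
    funext v
    exact (lineProj_eq_iff _ _).2 (hmk _)
  refine T2Space.of_injective_continuous (f := g) (fun p q h => ?_) ?_
  · rw [← hmk p, ← hmk q]
    exact (lineProj_eq_iff _ _).1 h
  · rw [isQuotientMap_mk'.continuous_iff, hg]
    exact hcont

end ComplexProjective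

/-! ### The Cayley equation as a quadratic form, and its regularity -/

namespace Conics

theorem conicMatrix_isSymm (x : Fin 6 → ℂ) : (conicMatrix x).IsSymm := by
  ext i j
  fin_cases i <;> fin_cases j <;> rfl

theorem conicMatrix_injective : Function.Injective conicMatrix := by
  intro x y h
  have h' : ∀ i j, conicMatrix x i j = conicMatrix y i j := fun i j => by rw [h]
  ext i
  fin_cases i
  exacts [h' 0 0, h' 0 1, h' 0 2, h' 1 1, h' 1 2, h' 2 2]

/-- The homogeneous coordinates of the conic with a given symmetric matrix. -/
def conicVec (A : Matrix (Fin 3) (Fin 3) ℂ) : Fin 6 → ℂ :=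
  ![A 0 0, A 0 1, A 0 2, A 1 1, A 1 2, A 2 2]

theorem conicMatrix_conicVec {A : Matrix (Fin 3) (Fin 3) ℂ} (hA : A.IsSymm) :
    conicMatrix (conicVec A) = A := by
  ext i j
  fin_cases i <;> fin_cases j <;> first | rfl | exact (hA.apply _ _)

theorem conicVec_conicMatrix (x : Fin 6 → ℂ) : conicVec (conicMatrix x) = x :=
  conicMatrix_injective (conicMatrix_conicVec (conicMatrix_isSymm x))

theorem continuous_conicVec : Continuous conicVec := by
  refine continuous_pi fun k => ?_
  fin_cases k <;> exact continuous_id.matrix_elem _ _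

theorem conicMatrix_add (x y : Fin 6 → ℂ) :
    conicMatrix (x + y) = conicMatrix x + conicMatrix y := by
  ext i j
  fin_cases i <;> fin_cases j <;> simp [conicMatrix]

@[simp]
theorem conicMatrix_zero : conicMatrix 0 = 0 := by
  ext i j
  fin_cases i <;> fin_cases j <;> simp [conicMatrix]

theorem continuous_conicMatrix : Continuous conicMatrix := by
  refine continuous_matrix fun i j => ?_
  fin_cases i <;> fin_cases j <;> exact continuous_apply _

/-- The left-hand side of the Cayley equation, in homogeneous coordinates. -/
def cayleyForm (x y : Fin 6 → ℂ) : ℂ :=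
  -(sigma12 (conicMatrix x) (conicMatrix y)) ^ 2 +
    4 * sigma03 (conicMatrix x) (conicMatrix y) * sigma21 (conicMatrix x) (conicMatrix y)

/-- The quadratic form `(tr KX)² - 2 tr (KX)²`. -/
def traceForm (K X : Matrix (Fin 3) (Fin 3) ℂ) : ℂ :=
  (K * X).trace ^ 2 - 2 * (K * X * (K * X)).trace

/-- Twice the polar form of `traceForm`. -/
def tracePolar (K X H : Matrix (Fin 3) (Fin 3) ℂ) : ℂ :=
  2 * (K * X).trace * (K * H).trace - 4 * (K * X * (K * H)).trace

/-- If `D` is invertible with adjugate `K`, then `KC = det D · D⁻¹C`; in the elementary symmetric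
functions of the eigenvalues of `D⁻¹C` both sides are `(det D)² (4e₂ - e₁²)`. -/
theorem cayleyForm_eq_traceForm (x y : Fin 6 → ℂ) :
    cayleyForm x y = traceForm (conicMatrix y).adjugate (conicMatrix x) := by
  rw [cayleyForm, sigma12_eq, sigma21_eq, sigma03_eq, traceForm, Matrix.adjugate_fin_three,
    Matrix.trace_fin_three, Matrix.trace_fin_three, Matrix.det_fin_three]
  simp only [Matrix.mul_apply, Fin.sum_univ_three, conicMatrix, Matrix.of_apply, Matrix.cons_val',
    Matrix.cons_val_zero, Matrix.cons_val_one, Matrix.cons_val_fin_one, Matrix.cons_val]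
  ring

theorem traceForm_add_smul (K X H : Matrix (Fin 3) (Fin 3) ℂ) (s : ℂ) :
    traceForm K (X + s • H) = traceForm K X + s * tracePolar K X H + s ^ 2 * traceForm K H := by
  have h : (K * H * (K * X)).trace = (K * X * (K * H)).trace := Matrix.trace_mul_comm _ _
  simp only [traceForm, tracePolar, Matrix.mul_add, Matrix.add_mul, Matrix.mul_smul,
    Matrix.smul_mul, Matrix.trace_add, Matrix.trace_smul, smul_eq_mul, h]
  ring

theorem tracePolar_self (K X : Matrix (Fin 3) (Fin 3) ℂ) :
    tracePolar K X X = 2 * traceForm K X := by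
  rw [tracePolar, traceForm]
  ring

theorem tracePolar_add_smul (K X H G : Matrix (Fin 3) (Fin 3) ℂ) (s : ℂ) :
    tracePolar K X (H + s • G) = tracePolar K X H + s * tracePolar K X G := by
  simp only [tracePolar, Matrix.mul_add, Matrix.mul_smul, Matrix.trace_add, Matrix.trace_smul,
    smul_eq_mul]
  ring

open scoped ComplexOrder in
/-- The polar form of the Cayley equation in the first conic is nondegenerate. -/
theorem eq_zero_of_tracePolar_eq_zero {x y : Fin 6 → ℂ} (hy : (conicMatrix y).det ≠ 0)
    (h : ∀ v, tracePolar (conicMatrix y).adjugate (conicMatrix x) (conicMatrix v) = 0) :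
    x = 0 := by
  set D := conicMatrix y with hD
  set X := conicMatrix x with hX
  set K := D.adjugate with hK
  have hKD : K * D = D.det • (1 : Matrix (Fin 3) (Fin 3) ℂ) := Matrix.adjugate_mul D
  have hDK : D * K = D.det • (1 : Matrix (Fin 3) (Fin 3) ℂ) := Matrix.mul_adjugate D
  have hKs : Kᵀ = K := by
    rw [hK, Matrix.adjugate_transpose, (conicMatrix_isSymm y).eq]
  have hXs : Xᵀ = X := conicMatrix_isSymm x
  -- Test against `D` itself: since `KD = det D · 1`, the polar form is `(6 - 4) det D · tr KX`.
  have ht : (K * X).trace = 0 := by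
    have := h y
    rw [tracePolar, hKD] at this
    simp only [Matrix.mul_smul, Matrix.mul_one, Matrix.trace_smul, Matrix.trace_one,
      smul_eq_mul, Fintype.card_fin] at this
    have h2 : 2 * D.det * (K * X).trace = 0 := by
      push_cast at this
      linear_combination this
    exact (mul_eq_zero.1 h2).resolve_left (mul_ne_zero two_ne_zero hy)
  have hZ : K * X * K = 0 := by
    have hs : (K * X * K)ᵀ = K * X * K := by
      simp only [Matrix.transpose_mul, hKs, hXs, Matrix.mul_assoc]
    -- With `tr KX = 0`, testing against the symmetric matrix `(KXK)ᴴ` gives a multiple of the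
    -- squared Frobenius norm of `KXK`.
    have hv := conicMatrix_conicVec (A := (K * X * K)ᴴ) (by
      rw [Matrix.IsSymm, Matrix.conjTranspose, hs, ← Matrix.transpose_map, hs])
    have := h (conicVec (K * X * K)ᴴ)
    rw [tracePolar, ht, hv, ← Matrix.mul_assoc] at this
    have h2 : (K * X * K * (K * X * K)ᴴ).trace = 0 := by linear_combination (-1 / 4) * this
    exact Matrix.trace_mul_conjTranspose_self_eq_zero_iff.1 h2
  have hX0 : D.det ^ 2 • X = 0 := by
    have : D * (K * X * K) * D = D.det ^ 2 • X := by
      rw [show D * (K * X * K) * D = (D * K) * X * (K * D) by simp only [Matrix.mul_assoc], hDK,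
        hKD]
      simp [smul_smul, pow_two]
    rw [← this, hZ]
    simp
  refine conicMatrix_injective ?_
  rw [conicMatrix_zero]
  exact (smul_eq_zero.1 hX0).resolve_left (pow_ne_zero _ hy)

/-- Both the common point and the linear relation between gradients can be scaled to norm 1, so the
witnesses of failure range over a compact space. -/
theorem not_meetTransversely_iff (C D : Matrix (Fin 3) (Fin 3) ℂ) :
    ¬ MeetTransversely C D ↔ ∃ v ∈ Metric.sphere (0 : Fin 3 → ℂ) 1,
      ∃ w ∈ Metric.sphere (0 : ℂ × ℂ) 1, v ⬝ᵥ (C *ᵥ v) = 0 ∧ v ⬝ᵥ (D *ᵥ v) = 0 ∧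
        w.1 • C *ᵥ v + w.2 • D *ᵥ v = 0 := by
  constructor
  · intro h
    simp only [MeetTransversely, not_forall] at h
    obtain ⟨v, hv, hC, hD, h⟩ := h
    rw [LinearIndependent.pair_iff] at h
    push Not at h
    obtain ⟨s, t, hst, hne⟩ := h
    have hw : ((s, t) : ℂ × ℂ) ≠ 0 := by
      intro h0
      rw [Prod.mk_eq_zero] at h0
      exact hne h0.1 h0.2
    refine ⟨((‖v‖⁻¹ : ℝ) : ℂ) • v, ?_, ((‖(s, t)‖⁻¹ : ℝ) : ℂ) • (s, t), ?_, ?_, ?_, ?_⟩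
    · rw [mem_sphere_zero_iff_norm, norm_smul, Complex.norm_real, norm_inv, norm_norm,
        inv_mul_cancel₀ (norm_ne_zero_iff.2 hv)]
    · rw [mem_sphere_zero_iff_norm, norm_smul, Complex.norm_real, norm_inv, norm_norm,
        inv_mul_cancel₀ (norm_ne_zero_iff.2 hw)]
    · simp [Matrix.mulVec_smul, hC]
    · simp [Matrix.mulVec_smul, hD]
    · rw [Prod.smul_fst, Prod.smul_snd, Matrix.mulVec_smul, Matrix.mulVec_smul]
      have : ∀ a b c d : ℂ, ∀ p q : Fin 3 → ℂ,
          (a • c) • b • p + (a • d) • b • q = (a * b) • (c • p + d • q) := by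
        intro a b c d p q
        ext i
        simp
        ring
      rw [this, hst, smul_zero]
  · rintro ⟨v, hv, w, hw, hC, hD, h⟩ hT
    have hv0 : v ≠ 0 := ne_zero_of_mem_unit_sphere ⟨v, hv⟩
    have hw0 : w ≠ 0 := ne_zero_of_mem_unit_sphere ⟨w, hw⟩
    obtain ⟨h1, h2⟩ := LinearIndependent.pair_iff.1 (hT v hv0 hC hD) _ _ h
    exact hw0 (Prod.ext h1 h2)

/-- The complement is the projection of a closed set along a compact factor, hence closed. -/
theorem isOpen_meetTransversely :
    IsOpen {p : Matrix (Fin 3) (Fin 3) ℂ × Matrix (Fin 3) (Fin 3) ℂ |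
      MeetTransversely p.1 p.2} := by
  rw [← isClosed_compl_iff]
  let Z : Set ((Metric.sphere (0 : Fin 3 → ℂ) 1 × Metric.sphere (0 : ℂ × ℂ) 1) ×
      (Matrix (Fin 3) (Fin 3) ℂ × Matrix (Fin 3) (Fin 3) ℂ)) :=
    {q | q.1.1.1 ⬝ᵥ (q.2.1 *ᵥ q.1.1.1) = 0 ∧ q.1.1.1 ⬝ᵥ (q.2.2 *ᵥ q.1.1.1) = 0 ∧
      q.1.2.1.1 • q.2.1 *ᵥ q.1.1.1 + q.1.2.1.2 • q.2.2 *ᵥ q.1.1.1 = 0}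
  have hv : Continuous fun q : (Metric.sphere (0 : Fin 3 → ℂ) 1 × Metric.sphere (0 : ℂ × ℂ) 1) ×
      (Matrix (Fin 3) (Fin 3) ℂ × Matrix (Fin 3) (Fin 3) ℂ) =>
    q.1.1.1 := by fun_prop
  have hw : Continuous fun q : (Metric.sphere (0 : Fin 3 → ℂ) 1 × Metric.sphere (0 : ℂ × ℂ) 1) ×
      (Matrix (Fin 3) (Fin 3) ℂ × Matrix (Fin 3) (Fin 3) ℂ) =>
    q.1.2.1 := by fun_prop
  have h1 := (continuous_fst.comp (continuous_snd
    (X := Metric.sphere (0 : Fin 3 → ℂ) 1 × Metric.sphere (0 : ℂ × ℂ) 1)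
    (Y := Matrix (Fin 3) (Fin 3) ℂ × Matrix (Fin 3) (Fin 3) ℂ))).matrix_mulVec hv
  have h2 := (continuous_snd.comp (continuous_snd
    (X := Metric.sphere (0 : Fin 3 → ℂ) 1 × Metric.sphere (0 : ℂ × ℂ) 1)
    (Y := Matrix (Fin 3) (Fin 3) ℂ × Matrix (Fin 3) (Fin 3) ℂ))).matrix_mulVec hv
  have hZ : IsClosed Z :=
    (isClosed_eq (hv.dotProduct h1) continuous_const).inter
      ((isClosed_eq (hv.dotProduct h2) continuous_const).inter
        (isClosed_eq ((hw.fst.smul h1).add (hw.snd.smul h2)) continuous_const))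
  convert isClosedMap_snd_of_compactSpace Z hZ using 1
  ext p
  rw [Set.mem_compl_iff, Set.mem_ofPred_eq, not_meetTransversely_iff]
  constructor
  · rintro ⟨v, hv, w, hw, h⟩
    exact ⟨((⟨v, hv⟩, ⟨w, hw⟩), p), h, rfl⟩
  · rintro ⟨⟨⟨v, w⟩, p⟩, h, rfl⟩
    exact ⟨v.1, v.2, w.1, w.2, h⟩

theorem contDiff_cayleyForm {E : Type*} [NormedAddCommGroup E] [NormedSpace ℂ E]
    {n : WithTop ℕ∞} {f g : E → Fin 6 → ℂ} (hf : ContDiff ℂ n f) (hg : ContDiff ℂ n g) :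
    ContDiff ℂ n fun e => cayleyForm (f e) (g e) := by
  have hf' := contDiff_pi.1 hf
  have hg' := contDiff_pi.1 hg
  simp only [cayleyForm, sigma12_eq, sigma21_eq, sigma03_eq, Matrix.det_fin_three, conicMatrix,
    Matrix.of_apply, Matrix.cons_val', Matrix.cons_val_zero, Matrix.cons_val_one,
    Matrix.cons_val_fin_one, Matrix.cons_val]
  fun_prop

/-- The Cayley equation in a product of two affine charts. -/
def affineCayley (i j : Fin 6) (q : (Fin 5 → ℂ) × (Fin 5 → ℂ)) : ℂ :=
  cayleyForm (i.insertNth (1 : ℂ) q.1) (j.insertNth (1 : ℂ) q.2)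

theorem contDiff_insertNth {n : WithTop ℕ∞} {m : ℕ} (i : Fin (m + 1)) :
    ContDiff ℂ n fun y : Fin m → ℂ => (i.insertNth (1 : ℂ) y : Fin (m + 1) → ℂ) := by
  refine contDiff_pi.2 fun k => ?_
  refine Fin.succAboveCases i ?_ (fun j => ?_) k
  · simpa using contDiff_const
  · simpa using contDiff_apply ℂ ℂ j

theorem contDiff_affineCayley {n : WithTop ℕ∞} (i j : Fin 6) :
    ContDiff ℂ n (affineCayley i j) :=
  contDiff_cayleyForm ((contDiff_insertNth i).comp contDiff_fst)
    ((contDiff_insertNth j).comp contDiff_snd)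

theorem insertNth_one_add_smul {m : ℕ} (i : Fin (m + 1)) (y h : Fin m → ℂ) (s : ℂ) :
    (i.insertNth (1 : ℂ) (y + s • h) : Fin (m + 1) → ℂ) =
      i.insertNth (1 : ℂ) y + s • i.insertNth (0 : ℂ) h := by
  ext k
  refine Fin.succAboveCases i ?_ (fun j => ?_) k <;> simp

/-- Only the first conic is varied. A vanishing derivative kills the polar form at `x` on all
directions with `i`-th coordinate 0. The one missing direction is `x` itself, where the polar form
is twice the value of the form, hence 0. Nondegeneracy then gives `x = 0`, against `x i = 1`. -/
theorem fderiv_affineCayley_ne_zero {i j : Fin 6} {q : (Fin 5 → ℂ) × (Fin 5 → ℂ)}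
    (hq : affineCayley i j q = 0)
    (hdet : (conicMatrix (j.insertNth (1 : ℂ) q.2)).det ≠ 0) :
    fderiv ℂ (affineCayley i j) q ≠ 0 := by
  intro h0
  set x : Fin 6 → ℂ := i.insertNth (1 : ℂ) q.1 with hx
  set y : Fin 6 → ℂ := j.insertNth (1 : ℂ) q.2 with hy
  have hform : traceForm (conicMatrix y).adjugate (conicMatrix x) = 0 := by
    rw [← cayleyForm_eq_traceForm]
    exact hq
  have hpolar : ∀ h : Fin 5 → ℂ, tracePolar (conicMatrix y).adjugate (conicMatrix x)
      (conicMatrix (i.insertNth (0 : ℂ) h)) = 0 := by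
    intro h
    have hline : HasDerivAt (fun s : ℂ => q + s • ((h, 0) : (Fin 5 → ℂ) × (Fin 5 → ℂ))) (h, 0) 0 := by
      simpa using ((hasDerivAt_id (0 : ℂ)).smul_const
        ((h, 0) : (Fin 5 → ℂ) × (Fin 5 → ℂ))).const_add q
    have h1 : HasFDerivAt (affineCayley i j) (0 : _ →L[ℂ] ℂ)
        (q + (0 : ℂ) • ((h, 0) : (Fin 5 → ℂ) × (Fin 5 → ℂ))) := by
      rw [zero_smul, add_zero, ← h0]
      exact ((contDiff_affineCayley (n := 1) i j).differentiable one_ne_zero _).hasFDerivAt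
    have h2 := h1.comp_hasDerivAt (0 : ℂ) hline
    have h3 : affineCayley i j ∘ (fun s : ℂ => q + s • ((h, 0) : (Fin 5 → ℂ) × (Fin 5 → ℂ))) =
        fun s => s * tracePolar (conicMatrix y).adjugate (conicMatrix x)
            (conicMatrix (i.insertNth (0 : ℂ) h)) +
          s ^ 2 * traceForm (conicMatrix y).adjugate (conicMatrix (i.insertNth (0 : ℂ) h)) := by
      funext s
      simp only [Function.comp_apply, affineCayley, Prod.fst_add, Prod.snd_add, Prod.smul_fst,
        Prod.smul_snd, smul_zero, add_zero]
      rw [insertNth_one_add_smul, cayleyForm_eq_traceForm, conicMatrix_add, conicMatrix_smul,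
        traceForm_add_smul, ← hx, ← hy, hform, zero_add]
    rw [h3] at h2
    have h4 := (((hasDerivAt_id (0 : ℂ)).mul_const (tracePolar (conicMatrix y).adjugate
      (conicMatrix x) (conicMatrix (i.insertNth (0 : ℂ) h)))).add
      (((hasDerivAt_id (0 : ℂ)).pow 2).mul_const
        (traceForm (conicMatrix y).adjugate (conicMatrix (i.insertNth (0 : ℂ) h)))))
    have h5 := h2.unique h4
    simpa using h5.symm
  have hx0 : x ≠ 0 := ComplexProjective.insertNth_one_ne_zero i q.1
  refine hx0 (eq_zero_of_tracePolar_eq_zero hdet fun v => ?_)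
  have hv : v = i.insertNth (0 : ℂ) (fun k => v (i.succAbove k) - v i * x (i.succAbove k)) +
      v i • x := by
    ext k
    refine Fin.succAboveCases i ?_ (fun j => ?_) k <;> simp [hx]
  rw [hv, conicMatrix_add, conicMatrix_smul, tracePolar_add_smul, hpolar, tracePolar_self, hform]
  simp

/-- The affine representative of a point is a multiple of any other one. -/
theorem insertNth_affineChart {m : ℕ} {i : Fin (m + 1)} {p : ℙ ℂ (Fin (m + 1) → ℂ)}
    (hp : p ∈ (ComplexProjective.affineChart i).source) :
    (i.insertNth (1 : ℂ) (ComplexProjective.affineChart i p) : Fin (m + 1) → ℂ) =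
      (p.rep i)⁻¹ • p.rep := by
  have hp' : p.rep i ≠ 0 := hp
  ext k
  refine Fin.succAboveCases i ?_ (fun j => ?_) k
  · simp [hp']
  · simp [ComplexProjective.affineChart, div_eq_inv_mul]

/-- The product of two projective spaces, charted on the product vector space. -/
instance instChartedSpaceProd : ChartedSpace ((Fin 5 → ℂ) × (Fin 5 → ℂ))
    (ℙ ℂ (Fin 6 → ℂ) × ℙ ℂ (Fin 6 → ℂ)) :=
  prodChartedSpace _ _ _ _

instance instIsManifoldProd : IsManifold 𝓘(ℂ, (Fin 5 → ℂ) × (Fin 5 → ℂ)) ω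
    (ℙ ℂ (Fin 6 → ℂ) × ℙ ℂ (Fin 6 → ℂ)) := by
  rw [modelWithCornersSelf_prod]
  exact IsManifold.prod _ _

/-- The determinant and transversality conditions cut out an open set, on which membership reduces
to the single equation `affineCayley i j = 0`. -/
theorem exists_sliceChart_cayleySet {p : ℙ ℂ (Fin 6 → ℂ) × ℙ ℂ (Fin 6 → ℂ)}
    (hp : p ∈ cayleySet) :
    ∃ s : SliceChart ℂ (Fin 9 → ℂ) ℂ ((Fin 5 → ℂ) × (Fin 5 → ℂ)) ω cayleySet,
      p ∈ s.chart.source := by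
  obtain ⟨i, hi⟩ := ComplexProjective.exists_rep_ne_zero p.1
  obtain ⟨j, hj⟩ := ComplexProjective.exists_rep_ne_zero p.2
  let c : OpenPartialHomeomorph (ℙ ℂ (Fin 6 → ℂ) × ℙ ℂ (Fin 6 → ℂ))
      ((Fin 5 → ℂ) × (Fin 5 → ℂ)) :=
    (ComplexProjective.affineChart i).prod (ComplexProjective.affineChart j)
  have hpc : p ∈ c.source := ⟨hi, hj⟩
  let P : (Fin 5 → ℂ) × (Fin 5 → ℂ) → Matrix (Fin 3) (Fin 3) ℂ × Matrix (Fin 3) (Fin 3) ℂ :=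
    fun q => (conicMatrix (i.insertNth (1 : ℂ) q.1), conicMatrix (j.insertNth (1 : ℂ) q.2))
  have hP : Continuous P :=
    (continuous_conicMatrix.comp ((contDiff_insertNth (n := 0) i).continuous.comp
      continuous_fst)).prodMk
    (continuous_conicMatrix.comp ((contDiff_insertNth (n := 0) j).continuous.comp continuous_snd))
  let W : Set ((Fin 5 → ℂ) × (Fin 5 → ℂ)) :=
    P ⁻¹' {q | q.1.det ≠ 0 ∧ q.2.det ≠ 0 ∧ MeetTransversely q.1 q.2}
  have hW : IsOpen W := by
    refine IsOpen.preimage hP ?_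
    exact (isOpen_ne_fun (Continuous.matrix_det continuous_fst) continuous_const).inter
      ((isOpen_ne_fun (Continuous.matrix_det continuous_snd) continuous_const).inter
        isOpen_meetTransversely)
  have hmem : ∀ x ∈ c.source, x ∈ cayleySet ↔ IsCayleyPair (P (c x)).1 (P (c x)).2 := by
    intro x hx
    have h1 : (P (c x)).1 = (x.1.rep i)⁻¹ • conicMatrix x.1.rep := by
      rw [← conicMatrix_smul, ← insertNth_affineChart hx.1]
      rfl
    have h2 : (P (c x)).2 = (x.2.rep j)⁻¹ • conicMatrix x.2.rep := by
      rw [← conicMatrix_smul, ← insertNth_affineChart hx.2]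
      rfl
    have hxi : x.1.rep i ≠ 0 := hx.1
    have hxj : x.2.rep j ≠ 0 := hx.2
    rw [h1, h2]
    refine ⟨fun h => h.smul (inv_ne_zero hxi) (inv_ne_zero hxj), fun h => ?_⟩
    have := h.smul hxi hxj
    rwa [smul_smul, smul_smul, mul_inv_cancel₀ hxi, mul_inv_cancel₀ hxj, one_smul,
      one_smul] at this
  have hpP := (hmem p hpc).1 hp
  have hc : c ∈ IsManifold.maximalAtlas 𝓘(ℂ, (Fin 5 → ℂ) × (Fin 5 → ℂ)) ω
      (ℙ ℂ (Fin 6 → ℂ) × ℙ ℂ (Fin 6 → ℂ)) := by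
    refine IsManifold.subset_maximalAtlas ?_
    exact ⟨_, Set.mem_range_self i, _, Set.mem_range_self j, rfl⟩
  refine exists_sliceChart_of_regular_zero (m := 9) (by simp) (by simp)
    (c.isOpen_inter_preimage hW) hc (contDiff_affineCayley i j) ⟨hpc, ?_⟩ hpc ?_ ?_
  · exact ⟨hpP.det_left_ne_zero, hpP.det_right_ne_zero, hpP.transverse⟩
  · intro x hx hxc
    rw [hmem x hxc]
    exact ⟨fun h => h.cayley, fun h => ⟨hx.2.1, hx.2.2.1, hx.2.2.2, h⟩⟩
  · exact fderiv_affineCayley_ne_zero hpP.cayley hpP.det_right_ne_zero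

theorem exists_isSmoothEmbedding_cayleySet (hne : cayleySet.Nonempty) :
    ∃ _ : ChartedSpace (Fin 9 → ℂ) cayleySet,
      IsManifold 𝓘(ℂ, Fin 9 → ℂ) ω cayleySet ∧
      Manifold.IsSmoothEmbedding 𝓘(ℂ, Fin 9 → ℂ) (𝓘(ℂ, Fin 5 → ℂ).prod 𝓘(ℂ, Fin 5 → ℂ)) ω
        (Subtype.val : cayleySet → ℙ ℂ (Fin 6 → ℂ) × ℙ ℂ (Fin 6 → ℂ)) := by
  rw [← modelWithCornersSelf_prod]
  exact exists_isSmoothEmbedding_of_sliceChart hne fun x hx => exists_sliceChart_cayleySet hx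

end Conics

/-! ### Connectedness of complements of hypersurfaces -/

/-- The complement of the zero set of a function that is polynomial along lines is connected. -/
theorem isPreconnected_ne_zero_of_polynomial {V : Type*} [AddCommGroup V] [Module ℂ V]
    [TopologicalSpace V] [IsTopologicalAddGroup V] [ContinuousSMul ℂ V] {f : V → ℂ}
    (hf : ∀ x y, ∃ q : Polynomial ℂ, ∀ z, f (x + z • (y - x)) = q.eval z) :
    IsPreconnected {x | f x ≠ 0} := by
  refine isPreconnected_of_forall_pair fun x hx y hy => ?_
  obtain ⟨q, hq⟩ := hf x y
  have h0 : q.eval 0 ≠ 0 := by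
    rw [← hq]
    simpa using hx
  have hq0 : q ≠ 0 := by
    rintro rfl
    simp at h0
  -- On the complex line through `x` and `y` only finitely many points are removed, and a real plane
  -- minus a countable set is connected.
  have hc : IsPreconnected {z : ℂ | q.eval z = 0}ᶜ := by
    refine ((Set.Finite.countable ?_).isConnected_compl_of_one_lt_rank ?_).isPreconnected
    · exact Polynomial.finite_setOfPred_isRoot hq0
    · rw [Complex.rank_real_complex]
      exact Nat.one_lt_ofNat
  refine ⟨(fun z : ℂ => x + z • (y - x)) '' {z : ℂ | q.eval z = 0}ᶜ, ?_, ?_, ?_,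
    hc.image _ (by fun_prop)⟩
  · rintro _ ⟨z, hz, rfl⟩
    change f _ ≠ 0
    rw [hq]
    exact hz
  · exact ⟨0, h0, by simp⟩
  · refine ⟨1, ?_, by simp⟩
    change q.eval 1 ≠ 0
    rw [← hq]
    simpa using hy

/-! ### Congruence and simultaneous diagonalization -/

namespace Conics

theorem pencilDet_congr (P C D : Matrix (Fin 3) (Fin 3) ℂ) :
    pencilDet (Pᵀ * C * P) (Pᵀ * D * P) = Polynomial.C (P.det ^ 2) * pencilDet C D := by
  have h : (Polynomial.X : Polynomial ℂ) • (Pᵀ * C * P).map Polynomial.C +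
      (Pᵀ * D * P).map Polynomial.C = (P.map Polynomial.C)ᵀ *
        ((Polynomial.X : Polynomial ℂ) • C.map Polynomial.C + D.map Polynomial.C) *
          P.map Polynomial.C := by
    simp only [Matrix.map_mul, Matrix.mul_add, Matrix.add_mul, Matrix.mul_smul, Matrix.smul_mul,
      Matrix.transpose_map]
  have hP : (P.map Polynomial.C).det = Polynomial.C P.det := (RingHom.map_det _ _).symm
  rw [pencilDet, h, Matrix.det_mul, Matrix.det_mul, Matrix.det_transpose, hP, pencilDet, map_pow]
  ring

theorem MeetTransversely.congr {C D P : Matrix (Fin 3) (Fin 3) ℂ} (hP : P.det ≠ 0)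
    (h : MeetTransversely C D) : MeetTransversely (Pᵀ * C * P) (Pᵀ * D * P) := by
  have hform : ∀ (A : Matrix (Fin 3) (Fin 3) ℂ) (v : Fin 3 → ℂ),
      (Pᵀ * A * P) *ᵥ v = Pᵀ *ᵥ (A *ᵥ (P *ᵥ v)) := fun A v => by
    simp only [Matrix.mulVec_mulVec, Matrix.mul_assoc]
  intro v hv hC hD
  rw [hform, Matrix.dotProduct_mulVec, Matrix.vecMul_transpose] at hC hD
  have hPv : P *ᵥ v ≠ 0 := fun h0 => hv (Matrix.eq_zero_of_mulVec_eq_zero hP h0)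
  have hli := LinearIndependent.pair_iff.1 (h _ hPv hC hD)
  rw [hform, hform, LinearIndependent.pair_iff]
  intro s t hst
  rw [← Matrix.mulVec_smul Pᵀ s, ← Matrix.mulVec_smul Pᵀ t, ← Matrix.mulVec_add] at hst
  exact hli s t (Matrix.eq_zero_of_mulVec_eq_zero (by rwa [Matrix.det_transpose]) hst)

theorem IsCayleyPair.congr {C D P : Matrix (Fin 3) (Fin 3) ℂ} (hP : P.det ≠ 0)
    (h : IsCayleyPair C D) : IsCayleyPair (Pᵀ * C * P) (Pᵀ * D * P) where
  det_left_ne_zero := by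
    rw [Matrix.det_mul, Matrix.det_mul, Matrix.det_transpose]
    exact mul_ne_zero (mul_ne_zero hP h.det_left_ne_zero) hP
  det_right_ne_zero := by
    rw [Matrix.det_mul, Matrix.det_mul, Matrix.det_transpose]
    exact mul_ne_zero (mul_ne_zero hP h.det_right_ne_zero) hP
  transverse := h.transverse.congr hP
  cayley := by
    have := h.cayley
    simp only [sigma12, sigma03, sigma21, pencilDet_congr, Polynomial.coeff_C_mul] at this ⊢
    linear_combination P.det ^ 4 * this

theorem sigma_diagonal_one (l : Fin 3 → ℂ) :
    sigma12 (Matrix.diagonal l) 1 = l 0 + l 1 + l 2 ∧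
      sigma21 (Matrix.diagonal l) 1 = l 0 * l 1 + l 0 * l 2 + l 1 * l 2 ∧
      sigma03 (Matrix.diagonal l) 1 = 1 := by
  rw [sigma12_eq, sigma21_eq, sigma03_eq]
  refine ⟨by simp, ?_, by simp⟩
  simp
  ring

/-- In a relation with `s ≠ 0`, `s * l j + t` vanishes for at most one `j`, so `v` has a single
nonzero coordinate and cannot be isotropic. -/
theorem meetTransversely_diagonal_one {l : Fin 3 → ℂ} (hl : Function.Injective l) :
    MeetTransversely (Matrix.diagonal l) 1 := by
  intro v hv hC hD
  rw [LinearIndependent.pair_iff]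
  intro s t hst
  have hst' : ∀ i, (s * l i + t) * v i = 0 := by
    intro i
    have := congrFun hst i
    simp only [Matrix.one_mulVec, Pi.add_apply, Pi.smul_apply, smul_eq_mul,
      Matrix.mulVec_diagonal, Pi.zero_apply] at this
    linear_combination this
  have hs : s = 0 := by
    by_contra hs
    obtain ⟨i, hi⟩ := Function.ne_iff.1 hv
    have hi' : s * l i + t = 0 := (mul_eq_zero.1 (hst' i)).resolve_right hi
    have hj : ∀ j, j ≠ i → v j = 0 := by
      intro j hji
      refine (mul_eq_zero.1 (hst' j)).resolve_left fun h => hji (hl ?_)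
      exact mul_left_cancel₀ hs (by linear_combination h - hi')
    rw [Matrix.one_mulVec, dotProduct, Finset.sum_eq_single i (fun j _ h => by simp [hj j h])
      (by simp)] at hD
    exact hi (mul_self_eq_zero.1 hD)
  refine ⟨hs, ?_⟩
  obtain ⟨i, hi⟩ := Function.ne_iff.1 hv
  simpa [hs] using (mul_eq_zero.1 (hst' i)).resolve_right hi

/-- If `l i = l j`, then `eᵢ + √-1 eⱼ` is an isotropic eigenvector: a common point at which the
gradients are proportional. -/
theorem MeetTransversely.injective_of_diagonal_one {l : Fin 3 → ℂ}
    (h : MeetTransversely (Matrix.diagonal l) 1) : Function.Injective l := by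
  intro i j hij
  by_contra hne
  let v : Fin 3 → ℂ := Pi.single i 1 + Pi.single j Complex.I
  have hv : v ≠ 0 := fun h0 => by
    have := congrFun h0 i
    simp [v, hne] at this
  have hvv : v ⬝ᵥ v = 0 := by
    simp [v, dotProduct_add, hne, Ne.symm hne]
  have hlv : Matrix.diagonal l *ᵥ v = l i • v := by
    ext k
    simp only [Matrix.mulVec_diagonal, Pi.smul_apply, smul_eq_mul]
    by_cases hki : k = i
    · rw [hki]
    · by_cases hkj : k = j
      · rw [hkj, hij]
      · simp [v, hki, hkj]
  have := LinearIndependent.pair_iff.1 (h v hv (by rw [hlv, dotProduct_smul, hvv, smul_zero])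
    (by rw [Matrix.one_mulVec, hvv])) 1 (-l i) (by simp [hlv])
  exact one_ne_zero this.1

theorem isCayleyPair_diagonal_one_iff {l : Fin 3 → ℂ} :
    IsCayleyPair (Matrix.diagonal l) 1 ↔ (∀ i, l i ≠ 0) ∧ Function.Injective l ∧
      (l 0 + l 1 + l 2) ^ 2 = 4 * (l 0 * l 1 + l 0 * l 2 + l 1 * l 2) := by
  obtain ⟨h1, h2, h3⟩ := sigma_diagonal_one l
  constructor
  · intro h
    refine ⟨?_, h.transverse.injective_of_diagonal_one, ?_⟩
    · simpa [Matrix.det_diagonal, Finset.prod_ne_zero_iff] using h.det_left_ne_zero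
    · have := h.cayley
      rw [h1, h2, h3] at this
      linear_combination -this
  · rintro ⟨h0, hl, h⟩
    refine ⟨?_, by simp, meetTransversely_diagonal_one hl, ?_⟩
    · simpa [Matrix.det_diagonal, Finset.prod_ne_zero_iff] using h0
    · rw [h1, h2, h3]
      linear_combination -h

theorem dotProduct_mulVec_comm {A : Matrix (Fin 3) (Fin 3) ℂ} (hA : A.IsSymm) (u v : Fin 3 → ℂ) :
    u ⬝ᵥ (A *ᵥ v) = v ⬝ᵥ (A *ᵥ u) := by
  rw [Matrix.dotProduct_mulVec, ← Matrix.mulVec_transpose, hA.eq, dotProduct_comm]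

/-- An eigenvector `w` of `D⁻¹C` with `wᵀDw = 0` would lie on both conics with `Cw = μ Dw`,
contradicting transversality. So `wᵀDw ≠ 0`, and dividing by a square root of it normalizes `w`. The
invariant subspace `W` is there for the induction that follows. -/
theorem exists_unit_eigenvector {C D : Matrix (Fin 3) (Fin 3) ℂ} (hD : D.det ≠ 0)
    (hT : MeetTransversely C D) {W : Submodule ℂ (Fin 3 → ℂ)} (hW : W ≠ ⊥)
    (hinv : ∀ w ∈ W, (D⁻¹ * C) *ᵥ w ∈ W) :
    ∃ v ∈ W, ∃ μ : ℂ, C *ᵥ v = μ • D *ᵥ v ∧ v ⬝ᵥ (D *ᵥ v) = 1 := by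
  have := (Submodule.nontrivial_iff_ne_bot).2 hW
  let T : Module.End ℂ W := (Matrix.toLin' (D⁻¹ * C)).restrict (fun w hw => by
    simpa using hinv w hw)
  obtain ⟨μ, hμ⟩ := Module.End.exists_eigenvalue T
  obtain ⟨w, hw⟩ := hμ.exists_hasEigenvector
  have hw0 : (w : Fin 3 → ℂ) ≠ 0 := by simpa using hw.2
  have hAw : (D⁻¹ * C) *ᵥ (w : Fin 3 → ℂ) = μ • (w : Fin 3 → ℂ) := by
    have := congrArg (Subtype.val) hw.apply_eq_smul
    simpa [T] using this
  have hCw : C *ᵥ (w : Fin 3 → ℂ) = μ • D *ᵥ (w : Fin 3 → ℂ) := by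
    have := congrArg (D *ᵥ ·) hAw
    simpa only [Matrix.mulVec_mulVec, Matrix.mulVec_smul,
      Matrix.mul_nonsing_inv_cancel_left _ _ (isUnit_iff_ne_zero.2 hD)] using this
  have hne : (w : Fin 3 → ℂ) ⬝ᵥ (D *ᵥ w) ≠ 0 := by
    intro h0
    have hli := LinearIndependent.pair_iff.1 (hT w hw0 (by
      rw [hCw, dotProduct_smul, h0, smul_zero]) h0) 1 (-μ) (by simp [hCw])
    exact one_ne_zero hli.1
  obtain ⟨r, hr⟩ := IsAlgClosed.exists_pow_nat_eq ((w : Fin 3 → ℂ) ⬝ᵥ (D *ᵥ w)) two_pos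
  have hr0 : r ≠ 0 := by
    rintro rfl
    exact hne (by simpa using hr.symm)
  refine ⟨r⁻¹ • w, W.smul_mem _ w.2, μ, ?_, ?_⟩
  · rw [Matrix.mulVec_smul, Matrix.mulVec_smul, hCw, smul_comm]
  · rw [Matrix.mulVec_smul, dotProduct_smul, smul_dotProduct, ← hr, smul_eq_mul, smul_eq_mul]
    field_simp

/-- Induction on `k`: the `D`-orthogonal complement of the vectors found so far is nonzero, being
cut out by fewer than 3 equations, and it is `D⁻¹C`-invariant because `vᵢᵀCw = μᵢ vᵢᵀDw`. -/
theorem exists_orthonormal_eigenvectors {C D : Matrix (Fin 3) (Fin 3) ℂ} (hCs : C.IsSymm)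
    (hDs : D.IsSymm) (hD : D.det ≠ 0) (hT : MeetTransversely C D) {k : ℕ} (hk : k ≤ 3) :
    ∃ (v : Fin k → Fin 3 → ℂ) (μ : Fin k → ℂ), (∀ i, C *ᵥ v i = μ i • D *ᵥ v i) ∧
      ∀ i j, v i ⬝ᵥ (D *ᵥ v j) = if i = j then 1 else 0 := by
  induction k with
  | zero => exact ⟨Fin.elim0, Fin.elim0, fun i => i.elim0, fun i => i.elim0⟩
  | succ k ih =>
    obtain ⟨v, μ, hv, ho⟩ := ih (by omega)
    let F : (Fin 3 → ℂ) →ₗ[ℂ] (Fin k → ℂ) := Matrix.toLin' (Matrix.of v * D)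
    have hF : ∀ w i, F w i = v i ⬝ᵥ (D *ᵥ w) := by
      intro w i
      simp only [F, Matrix.toLin'_apply, ← Matrix.mulVec_mulVec]
      rfl
    have hker : LinearMap.ker F ≠ ⊥ := LinearMap.ker_ne_bot_of_finrank_lt (by simp; omega)
    have hinv : ∀ w ∈ LinearMap.ker F, (D⁻¹ * C) *ᵥ w ∈ LinearMap.ker F := by
      intro w hw
      rw [LinearMap.mem_ker] at hw ⊢
      ext i
      have hw' : v i ⬝ᵥ (D *ᵥ w) = 0 := by rw [← hF, hw, Pi.zero_apply]
      rw [hF, Matrix.mulVec_mulVec, Matrix.mul_nonsing_inv_cancel_left _ _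
        (isUnit_iff_ne_zero.2 hD), dotProduct_mulVec_comm hCs, hv, dotProduct_smul,
        dotProduct_mulVec_comm hDs, hw', smul_zero, Pi.zero_apply]
    obtain ⟨u, hu, ν, hCu, huu⟩ := exists_unit_eigenvector hD hT hker hinv
    have hvu : ∀ i, v i ⬝ᵥ (D *ᵥ u) = 0 := fun i => by
      rw [← hF, LinearMap.mem_ker.1 hu, Pi.zero_apply]
    refine ⟨Fin.cons u v, Fin.cons ν μ, fun i => ?_, fun i j => ?_⟩
    · refine Fin.cases ?_ (fun i => ?_) i
      · simpa using hCu
      · simpa using hv i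
    · refine Fin.cases ?_ (fun i => ?_) i <;> refine Fin.cases ?_ (fun j => ?_) j
      · simpa using huu
      · rw [Fin.cons_zero, Fin.cons_succ, dotProduct_mulVec_comm hDs, hvu,
          if_neg (Fin.succ_ne_zero j).symm]
      · rw [Fin.cons_zero, Fin.cons_succ, hvu, if_neg (Fin.succ_ne_zero i)]
      · simpa using ho i j

theorem exists_simultaneous_diagonalization {C D : Matrix (Fin 3) (Fin 3) ℂ} (hCs : C.IsSymm)
    (hDs : D.IsSymm) (hD : D.det ≠ 0) (hT : MeetTransversely C D) :
    ∃ (Q : Matrix (Fin 3) (Fin 3) ℂ) (l : Fin 3 → ℂ), Qᵀ * C * Q = Matrix.diagonal l ∧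
      Qᵀ * D * Q = 1 := by
  obtain ⟨v, μ, hv, ho⟩ := exists_orthonormal_eigenvectors hCs hDs hD hT le_rfl
  have hentry : ∀ (A : Matrix (Fin 3) (Fin 3) ℂ) i j,
      (Matrix.of v * A * (Matrix.of v)ᵀ) i j = v i ⬝ᵥ (A *ᵥ v j) := by
    intro A i j
    rw [Matrix.mul_assoc, Matrix.mul_apply']
    congr 1
  refine ⟨(Matrix.of v)ᵀ, μ, ?_, ?_⟩
  · ext i j
    rw [Matrix.transpose_transpose, hentry, hv, dotProduct_smul, ho, Matrix.diagonal_apply]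
    split_ifs with h <;> simp [h]
  · ext i j
    rw [Matrix.transpose_transpose, hentry, ho, Matrix.one_apply]

/-! ### Normal forms and connectedness of the Cayley set -/

/-- The polynomial whose nonvanishing makes `a²`, `b²`, `(a + b)²` nonzero and distinct. -/
def rootProduct (a b : ℂ) : ℂ := a * b * (a + b) * (a - b) * (2 * a + b) * (a + 2 * b)

theorem isCayleyPair_diagonal_squares {a b : ℂ} (h : rootProduct a b ≠ 0) :
    IsCayleyPair (Matrix.diagonal ![a ^ 2, b ^ 2, (a + b) ^ 2]) 1 := by
  simp only [rootProduct, mul_ne_zero_iff] at h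
  obtain ⟨⟨⟨⟨⟨ha, hb⟩, hab⟩, h1⟩, h2⟩, h3⟩ := h
  have h01 : a ^ 2 ≠ b ^ 2 := fun h => mul_ne_zero hab h1 (by linear_combination h)
  have h02 : a ^ 2 ≠ (a + b) ^ 2 := fun h => mul_ne_zero hb h2 (by linear_combination -h)
  have h12 : b ^ 2 ≠ (a + b) ^ 2 := fun h => mul_ne_zero ha h3 (by linear_combination -h)
  rw [isCayleyPair_diagonal_one_iff]
  refine ⟨fun i => ?_, fun i j hij => ?_, ?_⟩
  · fin_cases i <;> simp [ha, hb, hab]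
  · fin_cases i <;> fin_cases j <;> simp_all [eq_comm]
  · simp only [Matrix.cons_val_zero, Matrix.cons_val_one, Matrix.cons_val]
    ring

/-- With `l 0 = a²` and `l 1 = b²`, the Cayley equation is quadratic in `l 2` with roots `(a + b)²`
and `(a - b)²`; the sign is absorbed into the choice of `b`. -/
theorem exists_squares_of_isCayleyPair_diagonal {l : Fin 3 → ℂ}
    (h : IsCayleyPair (Matrix.diagonal l) 1) :
    ∃ a b, rootProduct a b ≠ 0 ∧ l = ![a ^ 2, b ^ 2, (a + b) ^ 2] := by
  obtain ⟨h0, hl, heq⟩ := isCayleyPair_diagonal_one_iff.1 h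
  obtain ⟨a, ha⟩ : ∃ a, l 0 = a ^ 2 :=
    (IsAlgClosed.exists_pow_nat_eq (l 0) two_pos).imp fun _ h => h.symm
  obtain ⟨b, hb⟩ : ∃ b, l 1 = b ^ 2 :=
    (IsAlgClosed.exists_pow_nat_eq (l 1) two_pos).imp fun _ h => h.symm
  have h01 : l 0 ≠ l 1 := hl.ne (by decide)
  have h02 : l 0 ≠ l 2 := hl.ne (by decide)
  have h12 : l 1 ≠ l 2 := hl.ne (by decide)
  have key : ∀ c, l 1 = c ^ 2 → l 2 = (a + c) ^ 2 →
      ∃ a b, rootProduct a b ≠ 0 ∧ l = ![a ^ 2, b ^ 2, (a + b) ^ 2] := by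
    intro c hc h2
    refine ⟨a, c, ?_, ?_⟩
    · intro hz
      -- After substitution this product is `a²c² · rootProduct a c`.
      have : l 0 * l 1 * (l 0 - l 1) * (l 0 - l 2) * (l 1 - l 2) = 0 := by
        rw [ha, hc, h2]
        unfold rootProduct at hz
        linear_combination (a ^ 2 * c ^ 2) * hz
      simp [h0, sub_eq_zero, h01, h02, h12] at this
    · ext i
      fin_cases i
      exacts [ha, hc, h2]
  have hfac : (l 2 - (a + b) ^ 2) * (l 2 - (a + -b) ^ 2) = 0 := by
    rw [ha, hb] at heq
    linear_combination heq
  rcases mul_eq_zero.1 hfac with h2 | h2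
  · exact key b hb (sub_eq_zero.1 h2)
  · exact key (-b) (by rw [hb]; ring) (sub_eq_zero.1 h2)

/-- The parameter space of normal forms `(Pᵀ L P, Pᵀ P)` of Cayley pairs. -/
def normalFormParams : Set (Matrix (Fin 3) (Fin 3) ℂ × ℂ × ℂ) :=
  {u | u.1.det * rootProduct u.2.1 u.2.2 ≠ 0}

theorem isPreconnected_normalFormParams : IsPreconnected normalFormParams := by
  refine isPreconnected_ne_zero_of_polynomial fun x y => ?_
  let lin : ℂ → ℂ → Polynomial ℂ := fun p q => Polynomial.C p + Polynomial.X * Polynomial.C (q - p)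
  have hlin : ∀ z p q, (lin p q).eval z = p + z * (q - p) := by
    intro z p q
    simp [lin]
  let M : Matrix (Fin 3) (Fin 3) (Polynomial ℂ) := Matrix.of fun i j => lin (x.1 i j) (y.1 i j)
  let a := lin x.2.1 y.2.1
  let b := lin x.2.2 y.2.2
  refine ⟨M.det * (a * b * (a + b) * (a - b) * (Polynomial.C 2 * a + b) *
    (a + Polynomial.C 2 * b)), fun z => ?_⟩
  have hM : M.det.eval z = (x + z • (y - x)).1.det := by
    rw [← Polynomial.coe_evalRingHom, RingHom.map_det]
    congr 1
    ext i j
    exact hlin _ _ _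
  simp only [Polynomial.eval_mul, hM, Polynomial.eval_add, Polynomial.eval_sub, Polynomial.eval_C,
    a, b, hlin, rootProduct]
  rfl

theorem IsCayleyPair.conicVec_ne_zero {C D : Matrix (Fin 3) (Fin 3) ℂ} (hCs : C.IsSymm)
    (hDs : D.IsSymm) (h : IsCayleyPair C D) : conicVec C ≠ 0 ∧ conicVec D ≠ 0 := by
  refine ⟨fun h0 => h.det_left_ne_zero ?_, fun h0 => h.det_right_ne_zero ?_⟩
  · rw [← conicMatrix_conicVec hCs, h0]
    simp
  · rw [← conicMatrix_conicVec hDs, h0]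
    simp

/-- The first matrix of the normal form. -/
def normalFormLeft (u : Matrix (Fin 3) (Fin 3) ℂ × ℂ × ℂ) : Matrix (Fin 3) (Fin 3) ℂ :=
  u.1ᵀ * Matrix.diagonal ![u.2.1 ^ 2, u.2.2 ^ 2, (u.2.1 + u.2.2) ^ 2] * u.1

/-- The second matrix of the normal form. -/
def normalFormRight (u : Matrix (Fin 3) (Fin 3) ℂ × ℂ × ℂ) : Matrix (Fin 3) (Fin 3) ℂ :=
  u.1ᵀ * 1 * u.1

theorem normalFormLeft_isSymm (u : Matrix (Fin 3) (Fin 3) ℂ × ℂ × ℂ) :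
    (normalFormLeft u).IsSymm := by
  simp [normalFormLeft, Matrix.IsSymm, Matrix.transpose_mul, Matrix.mul_assoc]

theorem normalFormRight_isSymm (u : Matrix (Fin 3) (Fin 3) ℂ × ℂ × ℂ) :
    (normalFormRight u).IsSymm := by
  simp [normalFormRight, Matrix.IsSymm, Matrix.transpose_mul]

theorem isCayleyPair_normalForm {u : Matrix (Fin 3) (Fin 3) ℂ × ℂ × ℂ}
    (hu : u ∈ normalFormParams) : IsCayleyPair (normalFormLeft u) (normalFormRight u) :=
  (isCayleyPair_diagonal_squares (right_ne_zero_of_mul hu)).congr (left_ne_zero_of_mul hu)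

theorem conicVec_normalForm_ne_zero (u : normalFormParams) :
    conicVec (normalFormLeft u.1) ≠ 0 ∧ conicVec (normalFormRight u.1) ≠ 0 :=
  (isCayleyPair_normalForm u.2).conicVec_ne_zero (normalFormLeft_isSymm _)
    (normalFormRight_isSymm _)

/-- If `Q` diagonalizes the pair, then `P = Q⁻¹` recovers it from its diagonal form. -/
theorem exists_normalForm {C D : Matrix (Fin 3) (Fin 3) ℂ} (hCs : C.IsSymm)
    (hDs : D.IsSymm) (h : IsCayleyPair C D) :
    ∃ u ∈ normalFormParams, normalFormLeft u = C ∧ normalFormRight u = D := by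
  obtain ⟨Q, l, hC, hD⟩ := exists_simultaneous_diagonalization hCs hDs h.det_right_ne_zero
    h.transverse
  have hQ : Q.det ≠ 0 := by
    intro h0
    have := congrArg Matrix.det hD
    rw [Matrix.det_mul, h0, mul_zero, Matrix.det_one] at this
    exact zero_ne_one this
  have hQu : IsUnit Q.det := isUnit_iff_ne_zero.2 hQ
  have hdiag := h.congr hQ
  rw [hC, hD] at hdiag
  obtain ⟨a, b, hab, rfl⟩ := exists_squares_of_isCayleyPair_diagonal hdiag
  have hback : ∀ A : Matrix (Fin 3) (Fin 3) ℂ, (Q⁻¹)ᵀ * (Qᵀ * A * Q) * Q⁻¹ = A := by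
    intro A
    have h1 : (Q⁻¹)ᵀ * Qᵀ = 1 := by
      rw [← Matrix.transpose_mul, Matrix.mul_nonsing_inv _ hQu, Matrix.transpose_one]
    calc (Q⁻¹)ᵀ * (Qᵀ * A * Q) * Q⁻¹ = ((Q⁻¹)ᵀ * Qᵀ) * A * (Q * Q⁻¹) := by
          simp only [Matrix.mul_assoc]
      _ = A := by rw [h1, Matrix.mul_nonsing_inv _ hQu, Matrix.one_mul, Matrix.mul_one]
  refine ⟨(Q⁻¹, a, b), mul_ne_zero ?_ hab, ?_, ?_⟩
  · exact (Matrix.isUnit_nonsing_inv_det _ hQu).ne_zero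
  · rw [normalFormLeft, ← hC, hback]
  · rw [normalFormRight, ← hD, hback]

/-- The pair of conics with given parameters. -/
def normalFormPoint (u : normalFormParams) : ℙ ℂ (Fin 6 → ℂ) × ℙ ℂ (Fin 6 → ℂ) :=
  (Projectivization.mk' ℂ ⟨conicVec (normalFormLeft u.1), (conicVec_normalForm_ne_zero u).1⟩,
    Projectivization.mk' ℂ ⟨conicVec (normalFormRight u.1), (conicVec_normalForm_ne_zero u).2⟩)

theorem continuous_normalFormPoint : Continuous normalFormPoint := by
  have hL : Continuous normalFormLeft := by
    unfold normalFormLeft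
    refine (continuous_fst.matrix_transpose.matrix_mul (Continuous.matrix_diagonal ?_)).matrix_mul
      continuous_fst
    refine continuous_pi fun i => ?_
    fin_cases i <;> simp <;> fun_prop
  have hR : Continuous normalFormRight :=
    (continuous_fst.matrix_transpose.matrix_mul continuous_const).matrix_mul continuous_fst
  have hmk := ComplexProjective.isQuotientMap_mk' (n := 5) |>.continuous
  exact (hmk.comp ((continuous_conicVec.comp (hL.comp continuous_subtype_val)).subtype_mk _)).prodMk
    (hmk.comp ((continuous_conicVec.comp (hR.comp continuous_subtype_val)).subtype_mk _))

theorem range_normalFormPoint : Set.range normalFormPoint = cayleySet := by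
  ext p
  constructor
  · rintro ⟨u, rfl⟩
    refine (mem_cayleySet_mk _ _ _ _).2 ?_
    rw [conicMatrix_conicVec (normalFormLeft_isSymm _),
      conicMatrix_conicVec (normalFormRight_isSymm _)]
    exact isCayleyPair_normalForm u.2
  · intro hp
    obtain ⟨u, hu, hl, hr⟩ := exists_normalForm (conicMatrix_isSymm _) (conicMatrix_isSymm _) hp
    have hl' : conicVec (normalFormLeft u) = p.1.rep := by rw [hl, conicVec_conicMatrix]
    have hr' : conicVec (normalFormRight u) = p.2.rep := by rw [hr, conicVec_conicMatrix]
    refine ⟨⟨u, hu⟩, Prod.ext ?_ ?_⟩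
    · rw [← p.1.mk_rep]
      exact congrArg (Projectivization.mk' ℂ) (Subtype.ext hl')
    · rw [← p.2.mk_rep]
      exact congrArg (Projectivization.mk' ℂ) (Subtype.ext hr')

theorem isConnected_cayleySet : IsConnected cayleySet := by
  have : PreconnectedSpace normalFormParams :=
    Subtype.preconnectedSpace isPreconnected_normalFormParams
  have hne : Nonempty normalFormParams :=
    -- The identity matrix with `a = 1`, `b = 2`, which gives the eigenvalues 1, 4, 9.
    ⟨⟨(1, 1, 2), by simp [normalFormParams, rootProduct]; norm_num⟩⟩
  rw [← range_normalFormPoint]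
  exact ⟨Set.range_nonempty _, isPreconnected_range continuous_normalFormPoint⟩

end Conics

end

theorem mainTheorem1 :
    IsConnected Conics.cayleySet ∧
    T2Space Conics.cayleySet ∧
    SecondCountableTopology Conics.cayleySet ∧
    ∃ _ : ChartedSpace (Fin 9 → ℂ) Conics.cayleySet,
      IsManifold 𝓘(ℂ, Fin 9 → ℂ) ω Conics.cayleySet ∧
      Manifold.IsSmoothEmbedding 𝓘(ℂ, Fin 9 → ℂ) (𝓘(ℂ, Fin 5 → ℂ).prod 𝓘(ℂ, Fin 5 → ℂ)) ω
        (Subtype.val : Conics.cayleySet → ℙ ℂ (Fin 6 → ℂ) × ℙ ℂ (Fin 6 → ℂ)) :=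
  ⟨Conics.isConnected_cayleySet, inferInstance, inferInstance,
    Conics.exists_isSmoothEmbedding_cayleySet Conics.isConnected_cayleySet.nonempty⟩
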